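/- Let $d \ge 3$ and $\epsilon \in (0,1)$. For $N \ge 1$ let $\mathbb T_N = (\mathbb Z/N\mathbb Z)^d$, and let $(Y_t)_{t\ge 0}$ be the continuous-time simple random walk with jump rate $1$, that is $Y_t = X_{N_t}$, where $(X_n)$ is the discrete-time simple random walk on $\mathbb T_N$ or on $\mathbb Z^d$ and $(N_t)$ is an independent Poisson process of intensity $1$. Let $P_x$ be its law when started at $x$. For a set $V$ let $H_V = \inf\{t \ge 0 : Y_t \in V\}$, and let $\tilde H_V = \inf\{t \ge \tau_1 : Y_t \in V\}$, where $\tau_1$ is the first jump time. Let $E[H_V]$ denote the expectation of $H_V$ for the walk on $\mathbb T_N$ with uniformly distributed starting point, and for $\mathsf V \subseteq \mathbb Z^d$ let $\operatorname{cap}(\mathsf V) = \sum_{x \in \mathsf V} P_x[\tilde H_{\mathsf V} = \infty]$, for the walk on $\mathbb Z^d$. Let $B(0,r) \subseteq \mathbb T_N$ be the closed ball in the $\ell_\infty$-distance, and let $\phi$ map each point of $B(0,N/4) \subseteq \mathbb T_N$ to its representative in $\mathbb Z^d$ with all coordinates in $[-N/4,N/4]$. Then there are constants $c, c' > 0$ depending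 only on $d$ and $\epsilon$ such that for all $N \ge 1$, all real $r_N$ with $1 \le r_N \le N^{1-\epsilon}$ and $r_N \le N/4$, and all non-empty $V \subseteq B(0,r_N) \subseteq \mathbb T_N$, the quantities $E[H_V]$ and $\operatorname{cap}(\phi(V))$ are positive and finite, and $$\left| \frac{N^d}{E[H_V]\,\operatorname{cap}(\phi(V))} - 1 \right| \le c\, N^{-c'} .$$ -/

import Mathlib

open MeasureTheory ProbabilityTheory
open scoped NNReal ENNReal

namespace TorusWalk

noncomputable section

/-- The torus `(ℤ/Nℤ)^d`. -/
abbrev Torus (d N : ℕ) : Type := Fin d → ZMod N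

/-- The lattice `ℤ^d`. -/
abbrev Lattice (d : ℕ) : Type := Fin d → ℤ

/-- The sample space: a sequence of labels of unit steps (a coordinate direction and a sign)
and a sequence of holding times. -/
abbrev Sample (d : ℕ) : Type := (ℕ → Fin d × Bool) × (ℕ → ℝ)

/-- The law on the sample space: the labels are i.i.d. uniform on the `2d` signed directions,
and, independently, the holding times are i.i.d. exponential of parameter `1`. -/
def sampleLaw (d : ℕ) : Measure (Sample d) :=
  (Measure.infinitePi fun _ : ℕ => uniformOn (Set.univ : Set (Fin d × Bool))).prod
    (Measure.infinitePi fun _ : ℕ => expMeasure 1)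

/-- The step `e_i` or `-e_i`, in `ℤ^d` (for `R = ℤ`) or in the torus (for `R = ZMod N`). -/
def unitStep {d : ℕ} (R : Type*) [Ring R] (s : Fin d × Bool) : Fin d → R :=
  Pi.single s.1 (if s.2 then 1 else -1)

/-- The discrete-time simple random walk `X_n` started at `x`. -/
def discreteWalk {d : ℕ} {R : Type*} [Ring R] (x : Fin d → R) (ω : Sample d) (n : ℕ) :
    Fin d → R :=
  x + ∑ k ∈ Finset.range n, unitStep R (ω.1 k)

/-- The `n`-th jump time `τ_n` (with `τ_0 = 0`), the sum of the first `n` holding times. The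
holding times are almost surely positive, so that `Real.toNNReal` only changes the type. -/
def jumpTime {d : ℕ} (ω : Sample d) (n : ℕ) : ℝ≥0 :=
  ∑ k ∈ Finset.range n, (ω.2 k).toNNReal

/-- The Poisson process `N_t` of intensity `1`: the number of jump times `τ_1, τ_2, …` up to
time `t`. -/
def poissonCount {d : ℕ} (ω : Sample d) (t : ℝ≥0) : ℕ :=
  Set.ncard {n : ℕ | 1 ≤ n ∧ jumpTime ω n ≤ t}

/-- The continuous-time simple random walk `Y_t = X_{N_t}` started at `x`. -/
def walk {d : ℕ} {R : Type*} [Ring R] (x : Fin d → R) (ω : Sample d) (t : ℝ≥0) : Fin d → R :=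
  discreteWalk x ω (poissonCount ω t)

/-- The entrance time `H_V = inf {t ≥ 0 : Y_t ∈ V}` of a trajectory, with `inf ∅ = ∞`. -/
def entranceTime {S : Type*} (V : Set S) (Y : ℝ≥0 → S) : ℝ≥0∞ :=
  ⨅ (t : ℝ≥0) (_ : Y t ∈ V), (t : ℝ≥0∞)

/-- The hitting time `H_V ∘ θ_{τ_1} + τ_1` of the walk started at `x`. -/
def hittingTime {d : ℕ} {R : Type*} [Ring R] (V : Set (Fin d → R)) (x : Fin d → R)
    (ω : Sample d) : ℝ≥0∞ :=
  entranceTime V (fun t => walk x ω (t + jumpTime ω 1)) + (jumpTime ω 1 : ℝ≥0∞)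

/-- The expectation `E_x[H_V]` for the walk on the torus started at `x`. -/
def expectedEntranceFrom {d N : ℕ} (V : Set (Torus d N)) (x : Torus d N) : ℝ≥0∞ :=
  ∫⁻ ω, entranceTime V (walk x ω) ∂(sampleLaw d)

/-- The expectation `E[H_V]` for the walk on the torus started from the uniform distribution. -/
def expectedEntrance {d N : ℕ} [NeZero N] (V : Set (Torus d N)) : ℝ≥0∞ :=
  ∑ x : Torus d N, ((N : ℝ≥0∞) ^ d)⁻¹ * expectedEntranceFrom V x

open Classical in
/-- The equilibrium measure `e_V(x) = 1_{x ∈ V} P_x[hitting time of V is infinite]` of a set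
`V` in `ℤ^d`. -/
def equilibriumMeasure {d : ℕ} (V : Set (Lattice d)) (x : Lattice d) : ℝ≥0∞ :=
  if x ∈ V then sampleLaw d {ω | hittingTime V x ω = ∞} else 0

/-- The capacity of `V` in `ℤ^d`: the total mass of its equilibrium measure. -/
def capacity {d : ℕ} (V : Set (Lattice d)) : ℝ≥0∞ :=
  ∑' x : Lattice d, equilibriumMeasure V x

/-- The closed ball `B(x, r)` of the torus in the `ℓ_∞`-distance; `|(y i - x i).valMinAbs|` is the
distance of the `i`-th coordinates in `ℤ/Nℤ`. -/
def torusBall {d N : ℕ} (x : Torus d N) (r : ℝ) : Set (Torus d N) :=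
  {y | ∀ i, |((y i - x i).valMinAbs : ℝ)| ≤ r}

/-- The map `φ` that lifts a point of the torus to its representative in `ℤ^d` with coordinates in
`(-N/2, N/2]`; on `B(0, N/4)` it is the bijection onto the ball `B(0, N/4)` of `ℤ^d` inverse to the
canonical projection. -/
def lift {d N : ℕ} (x : Torus d N) : Lattice d :=
  fun i => (x i).valMinAbs

end

end TorusWalk

namespace TorusWalk

noncomputable section

section

/-- The mean of `a` under the Poisson distribution with parameter `s`. -/
def poissonMean (s : ℝ) (a : ℕ → ℝ) : ℝ :=
  Real.exp (-s) * ∑' k : ℕ, s ^ k / (k.factorial : ℝ) * a k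

/-- Sequences that grow at most exponentially. -/
def ExpBounded (a : ℕ → ℝ) : Prop := ∃ C ρ : ℝ, ∀ k, |a k| ≤ C * ρ ^ k

lemma ExpBounded.of_abs_le {a : ℕ → ℝ} {C : ℝ} (h : ∀ k, |a k| ≤ C) : ExpBounded a :=
  ⟨C, 1, by simpa using h⟩

lemma ExpBounded.const_mul_pow (C ρ : ℝ) : ExpBounded fun k => C * ρ ^ k :=
  ⟨|C|, |ρ|, fun k => by rw [abs_mul, abs_pow]⟩

lemma ExpBounded.summable {a : ℕ → ℝ} (h : ExpBounded a) (s : ℝ) :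
    Summable fun k : ℕ => s ^ k / (k.factorial : ℝ) * a k := by
  obtain ⟨C, ρ, h⟩ := h
  refine Summable.of_norm_bounded (g := fun k : ℕ => |C| * ((|s| * |ρ|) ^ k / (k.factorial : ℝ)))
    ((Real.summable_pow_div_factorial _).mul_left _) fun k => ?_
  rw [Real.norm_eq_abs, abs_mul, abs_div, abs_pow, Nat.abs_cast]
  have h1 : |a k| ≤ |C| * |ρ| ^ k := (h k).trans ((le_abs_self _).trans (by rw [abs_mul, abs_pow]))
  calc |s| ^ k / (k.factorial : ℝ) * |a k| ≤ |s| ^ k / (k.factorial : ℝ) * (|C| * |ρ| ^ k) := by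
        gcongr
    _ = _ := by rw [mul_pow]; ring

lemma ExpBounded.add {a b : ℕ → ℝ} (ha : ExpBounded a) (hb : ExpBounded b) :
    ExpBounded fun k => a k + b k := by
  obtain ⟨C, ρ, ha⟩ := ha
  obtain ⟨D, σ, hb⟩ := hb
  refine ⟨|C| + |D|, max |ρ| |σ|, fun k => (abs_add_le _ _).trans ?_⟩
  rw [add_mul]
  refine add_le_add ((ha k).trans ((le_abs_self _).trans ?_))
    ((hb k).trans ((le_abs_self _).trans ?_)) <;> rw [abs_mul, abs_pow] <;> gcongr
  · exact le_max_left _ _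
  · exact le_max_right _ _

lemma ExpBounded.const_mul {a : ℕ → ℝ} (ha : ExpBounded a) (c : ℝ) :
    ExpBounded fun k => c * a k := by
  obtain ⟨C, ρ, ha⟩ := ha
  refine ⟨|c| * C, ρ, fun k => ?_⟩
  rw [abs_mul, mul_assoc]
  gcongr
  exact ha k

lemma poissonMean_add {a b : ℕ → ℝ} (ha : ExpBounded a) (hb : ExpBounded b) (s : ℝ) :
    poissonMean s (fun k => a k + b k) = poissonMean s a + poissonMean s b := by
  simp only [poissonMean, mul_add, (ha.summable s).tsum_add (hb.summable s)]

lemma poissonMean_const_mul (c : ℝ) (a : ℕ → ℝ) (s : ℝ) :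
    poissonMean s (fun k => c * a k) = c * poissonMean s a := by
  simp only [poissonMean]
  rw [mul_left_comm, ← tsum_mul_left (a := c)]
  congr 2; funext k; ring

lemma poissonMean_mono {a b : ℕ → ℝ} (ha : ExpBounded a) (hb : ExpBounded b) {s : ℝ} (hs : 0 ≤ s)
    (hab : ∀ k, a k ≤ b k) : poissonMean s a ≤ poissonMean s b := by
  unfold poissonMean
  gcongr with k
  · exact ha.summable s
  · exact hb.summable s
  · exact hab k

lemma tsum_pow_div_factorial (s : ℝ) : ∑' k : ℕ, s ^ k / (k.factorial : ℝ) = Real.exp s := by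
  rw [Real.exp_eq_exp_ℝ, NormedSpace.exp_eq_tsum_div]

lemma poissonMean_pow (C ρ s : ℝ) :
    poissonMean s (fun k => C * ρ ^ k) = C * Real.exp (s * (ρ - 1)) := by
  rw [poissonMean_const_mul]
  congr 1
  unfold poissonMean
  have : (fun k : ℕ => s ^ k / (k.factorial : ℝ) * ρ ^ k) =
      fun k : ℕ => (s * ρ) ^ k / (k.factorial : ℝ) := by
    ext k; rw [mul_pow]; ring
  rw [this, tsum_pow_div_factorial, ← Real.exp_add]
  ring_nf

lemma poissonMean_const (C s : ℝ) : poissonMean s (fun _ => C) = C := by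
  simpa using poissonMean_pow C 1 s

lemma poissonMean_nonneg {a : ℕ → ℝ} {s : ℝ} (hs : 0 ≤ s)
    (h : ∀ k, 0 ≤ a k) : 0 ≤ poissonMean s a :=
  mul_nonneg (Real.exp_pos _).le (tsum_nonneg fun k => mul_nonneg (by positivity) (h k))

lemma poissonMean_zero (a : ℕ → ℝ) : poissonMean 0 a = a 0 := by
  unfold poissonMean
  rw [tsum_eq_single 0]
  · simp
  · intro k hk; simp [hk]

lemma ExpBounded.finset_sum {ι : Type*} (S : Finset ι) {a : ι → ℕ → ℝ}
    (h : ∀ i ∈ S, ExpBounded (a i)) : ExpBounded fun k => ∑ i ∈ S, a i k := by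
  classical
  induction S using Finset.induction_on with
  | empty => exact .of_abs_le (C := 0) (by simp)
  | insert i S hi ih =>
    simp only [Finset.sum_insert hi]
    exact (h i (by simp)).add (ih fun j hj => h j (by simp [hj]))

lemma poissonMean_finset_sum {ι : Type*} (S : Finset ι) {a : ι → ℕ → ℝ} (s : ℝ)
    (h : ∀ i ∈ S, ExpBounded (a i)) :
    poissonMean s (fun k => ∑ i ∈ S, a i k) = ∑ i ∈ S, poissonMean s (a i) := by
  classical
  induction S using Finset.induction_on with
  | empty => simp [poissonMean]
  | insert i S hi ih =>
    simp only [Finset.sum_insert hi]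
    rw [poissonMean_add (h i (by simp)) (ExpBounded.finset_sum S fun j hj => h j (by simp [hj])),
      ih fun j hj => h j (by simp [hj])]

lemma hasDerivAt_poissonMean {a : ℕ → ℝ} {C : ℝ} (ha : ∀ k, |a k| ≤ C) (s : ℝ) :
    HasDerivAt (fun s => poissonMean s a)
      (poissonMean s (fun k => a (k + 1)) - poissonMean s a) s := by
  have hC : 0 ≤ C := (abs_nonneg _).trans (ha 0)
  set r : ℝ := |s| + 1 with hr
  set u : ℕ → ℝ := fun k => C * (k * r ^ (k - 1) / (k.factorial : ℝ)) with hu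
  have hr0 : 0 ≤ r := by positivity
  have hfac : ∀ (x : ℝ) (k : ℕ), ((k + 1 : ℕ) : ℝ) * x ^ (k + 1 - 1) / ((k + 1).factorial : ℝ) =
      x ^ k / (k.factorial : ℝ) := by
    intro x k
    rw [Nat.factorial_succ, Nat.add_sub_cancel]
    push_cast
    have : (k.factorial : ℝ) ≠ 0 := by positivity
    have : (k : ℝ) + 1 ≠ 0 := by positivity
    field_simp
  have hus : Summable u := by
    refine Summable.mul_left _ ((summable_nat_add_iff 1).1 ?_)
    simp only [hfac]
    exact Real.summable_pow_div_factorial r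
  have hmem : s ∈ Metric.ball (0 : ℝ) r := by simp [hr]
  have key := hasDerivAt_tsum_of_isPreconnected (𝕜 := ℝ) (u := u)
    (g := fun (k : ℕ) (x : ℝ) => x ^ k / (k.factorial : ℝ) * a k)
    (g' := fun (k : ℕ) (x : ℝ) => k * x ^ (k - 1) / (k.factorial : ℝ) * a k)
    (t := Metric.ball (0 : ℝ) r) (y₀ := s) (y := s) hus Metric.isOpen_ball
    (convex_ball (0 : ℝ) r).isPreconnected
    (fun k y _ => ((hasDerivAt_pow k y).div_const _).mul_const _)
    (fun k y hy => ?_) hmem ((ExpBounded.of_abs_le ha).summable s) hmem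
  · have h1 : ∑' k : ℕ, (k * s ^ (k - 1) / (k.factorial : ℝ) * a k) =
        ∑' k : ℕ, s ^ k / (k.factorial : ℝ) * a (k + 1) := by
      rw [Summable.tsum_eq_zero_add]
      · simp only [hfac]; simp
      · refine (summable_nat_add_iff 1).1 ?_
        simp only [hfac]
        exact (ExpBounded.of_abs_le (fun k => ha (k + 1))).summable s
    rw [h1] at key
    have h2 : HasDerivAt (fun s : ℝ => Real.exp (-s)) (-Real.exp (-s)) s := by
      simpa using (hasDerivAt_neg s).exp
    refine HasDerivAt.congr_deriv (h2.mul key) ?_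
    simp only [poissonMean]
    ring
  · rw [Real.norm_eq_abs, abs_mul, abs_div, abs_mul, abs_pow, Nat.abs_cast, Nat.abs_cast, hu,
      mul_comm]
    have hy' : |y| ≤ r := by simpa using (Metric.mem_ball.1 hy).le
    exact mul_le_mul (ha k) (by gcongr) (by positivity) hC

lemma poissonMean_inv_succ_le {s : ℝ} (hs : 0 < s) :
    poissonMean s (fun k => 1 / ((k : ℝ) + 1)) ≤ 1 / s := by
  have h : ∀ k : ℕ, s ^ k / (k.factorial : ℝ) * (1 / ((k : ℝ) + 1)) =
      s⁻¹ * (s ^ (k + 1) / ((k + 1).factorial : ℝ)) := by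
    intro k
    rw [Nat.factorial_succ]
    push_cast
    have : (k.factorial : ℝ) ≠ 0 := by positivity
    field_simp
    ring
  unfold poissonMean
  simp only [h]
  rw [tsum_mul_left]
  have h2 : ∑' k : ℕ, s ^ (k + 1) / ((k + 1).factorial : ℝ) ≤ Real.exp s := by
    have h3 := (Real.summable_pow_div_factorial s).tsum_eq_zero_add
    have h4 : ∑' k : ℕ, s ^ k / (k.factorial : ℝ) = Real.exp s := by
      exact tsum_pow_div_factorial s
    rw [h4] at h3
    rw [h3]; simp
  calc Real.exp (-s) * (s⁻¹ * ∑' k : ℕ, s ^ (k + 1) / ((k + 1).factorial : ℝ))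
      ≤ Real.exp (-s) * (s⁻¹ * Real.exp s) := by gcongr
    _ = 1 / s := by rw [mul_left_comm, ← Real.exp_add]; simp

lemma poissonMean_le_one_div_sqrt {a : ℕ → ℝ} (ha0 : ∀ k, 0 ≤ a k)
    (ha : ∀ k, a k ≤ 1 / √((k : ℝ) + 1)) {s : ℝ} (hs : 0 < s) : poissonMean s a ≤ 1 / √s := by
  have hsq : 0 < √s := Real.sqrt_pos.2 hs
  have hb : ExpBounded fun k : ℕ => 1 / ((k : ℝ) + 1) := .of_abs_le (C := 1) fun k => by
    rw [abs_of_nonneg (by positivity), div_le_one (by positivity)]; linarith [(k.cast_nonneg : (0:ℝ) ≤ k)]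
  have ha1 : ∀ k, a k ≤ √s / 2 * (1 / ((k : ℝ) + 1)) + 1 / (2 * √s) := by
    intro k
    refine (ha k).trans ?_
    have hk : 0 < √((k : ℝ) + 1) := Real.sqrt_pos.2 (by positivity)
    have h1 : (1 : ℝ) / ((k : ℝ) + 1) = (1 / √((k : ℝ) + 1)) ^ 2 := by
      rw [div_pow, Real.sq_sqrt (by positivity)]; simp
    rw [h1]
    set x := 1 / √((k : ℝ) + 1)
    have : √s / 2 * x ^ 2 + 1 / (2 * √s) - x = (√s * x - 1) ^ 2 / (2 * √s) := by
      field_simp; ring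
    have : 0 ≤ (√s * x - 1) ^ 2 / (2 * √s) := by positivity
    linarith
  have hae : ExpBounded a := .of_abs_le (C := 1) fun k => by
    rw [abs_of_nonneg (ha0 k)]
    refine (ha k).trans ?_
    rw [div_le_one (Real.sqrt_pos.2 (by positivity))]
    exact Real.one_le_sqrt.2 (by linarith [(k.cast_nonneg : (0:ℝ) ≤ k)])
  refine (poissonMean_mono hae ((hb.const_mul (√s / 2)).add
    (.of_abs_le (a := fun _ => 1 / (2 * √s)) fun _ => le_rfl)) hs.le ha1).trans ?_
  rw [poissonMean_add (hb.const_mul _) (.of_abs_le (a := fun _ => 1 / (2 * √s)) fun _ => le_rfl),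
    poissonMean_const_mul, poissonMean_const]
  have h2 := poissonMean_inv_succ_le hs
  calc _ ≤ √s / 2 * (1 / s) + 1 / (2 * √s) := by gcongr
    _ = 1 / √s := by
      nth_rewrite 2 [← Real.sq_sqrt hs.le]
      field_simp; norm_num

/-- The `k`-step transition kernel of the lazy walk on `R` that steps by `±1` with probability
`1/4` each. -/
def lazyKernel (R : Type*) [Ring R] [DecidableEq R] : ℕ → R → ℝ
  | 0, z => if z = 0 then 1 else 0
  | k + 1, z => lazyKernel R k (z - 1) / 4 + lazyKernel R k z / 2 + lazyKernel R k (z + 1) / 4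

section general
variable {R : Type*} [Ring R] [DecidableEq R]

lemma lazyKernel_nonneg (k : ℕ) (z : R) : 0 ≤ lazyKernel R k z := by
  induction k generalizing z with
  | zero => simp only [lazyKernel]; split_ifs <;> norm_num
  | succ k ih => simp only [lazyKernel]; linarith [ih (z - 1), ih z, ih (z + 1)]

lemma lazyKernel_le_one (k : ℕ) (z : R) : lazyKernel R k z ≤ 1 := by
  induction k generalizing z with
  | zero => simp only [lazyKernel]; split_ifs <;> norm_num
  | succ k ih => simp only [lazyKernel]; linarith [ih (z - 1), ih z, ih (z + 1)]

lemma abs_lazyKernel_le (z : R) (k : ℕ) : |lazyKernel R k z| ≤ 1 := by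
  rw [abs_of_nonneg (lazyKernel_nonneg k z)]; exact lazyKernel_le_one k z

lemma expBounded_lazyKernel (z : R) : ExpBounded fun k => lazyKernel R k z :=
  .of_abs_le (abs_lazyKernel_le z)

lemma lazyKernel_neg (k : ℕ) (z : R) : lazyKernel R k (-z) = lazyKernel R k z := by
  induction k generalizing z with
  | zero => simp [lazyKernel]
  | succ k ih =>
    simp only [lazyKernel]
    rw [show -z - 1 = -(z + 1) by abel, show -z + 1 = -(z - 1) by abel, ih, ih, ih]
    ring

lemma sum_lazyKernel [Fintype R] (k : ℕ) : ∑ z : R, lazyKernel R k z = 1 := by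
  induction k with
  | zero => simp [lazyKernel]
  | succ k ih =>
    simp only [lazyKernel, Finset.sum_add_distrib, ← Finset.sum_div]
    have h1 := (Equiv.subRight (1 : R)).sum_comp (lazyKernel R k)
    have h2 := Equiv.sum_comp (Equiv.addRight (1 : R)) (lazyKernel R k)
    simp only [Equiv.subRight_apply, Equiv.coe_addRight] at h1 h2
    rw [h1, h2, ih]
    norm_num

end general

lemma lazyKernel_antitone (k : ℕ) (n : ℕ) :
    lazyKernel ℤ k ((n : ℤ) + 1) ≤ lazyKernel ℤ k n := by
  induction k generalizing n with
  | zero =>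
    simp only [lazyKernel]
    rw [if_neg (by omega)]; split_ifs <;> norm_num
  | succ k ih =>
    simp only [lazyKernel]
    have h1 := ih n
    have h2 := ih (n + 1)
    push_cast at h2
    rcases n with _ | n
    · have h3 := lazyKernel_neg k (1 : ℤ)
      simp at h1 h2 h3 ⊢
      rw [h3]
      linarith
    · have h0 := ih n
      push_cast at h1 h2 h0 ⊢
      simp only [add_sub_cancel_right]
      linarith

lemma lazyKernel_le_of_abs_le (k : ℕ) {z w : ℤ} (h : |w| ≤ |z|) :
    lazyKernel ℤ k z ≤ lazyKernel ℤ k w := by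
  have h1 : ∀ z : ℤ, lazyKernel ℤ k z = lazyKernel ℤ k (z.natAbs : ℤ) := by
    intro z
    rcases Int.natAbs_eq z with h | h
    · rw [← h]
    · conv_lhs => rw [h]
      rw [lazyKernel_neg]
  rw [h1 z, h1 w]
  exact antitone_nat_of_succ_le (f := fun n : ℕ => lazyKernel ℤ k (n : ℤ))
    (fun n => by simpa using lazyKernel_antitone k n)
    (by rw [Int.abs_eq_natAbs, Int.abs_eq_natAbs] at h; exact_mod_cast h)

lemma lazyKernel_eq_zero (k : ℕ) (z : ℤ) (h : z < -k) : lazyKernel ℤ k z = 0 := by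
  induction k generalizing z with
  | zero => simp only [lazyKernel]; rw [if_neg (by omega)]
  | succ k ih =>
    push_cast at h
    simp only [lazyKernel]
    rw [ih _ (by omega), ih _ (by omega), ih _ (by omega)]; norm_num

lemma lazyKernel_eq_choose (k m : ℕ) :
    lazyKernel ℤ k ((m : ℤ) - k) = ((2 * k).choose m : ℝ) / 4 ^ k := by
  induction k generalizing m with
  | zero =>
    rcases m with _ | m
    · simp [lazyKernel]
    · simp only [lazyKernel]; rw [if_neg (by push_cast; omega)]; simp
  | succ k ih =>
    simp only [lazyKernel]
    rw [show ((m : ℤ) - (k + 1 : ℕ) + 1) = (m : ℤ) - k by push_cast; ring, ih m]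
    rcases m with _ | _ | m
    · rw [lazyKernel_eq_zero _ _ (by push_cast; omega), lazyKernel_eq_zero _ _ (by push_cast; omega)]
      simp [pow_succ]; ring
    · rw [lazyKernel_eq_zero _ _ (by push_cast; omega)]
      rw [show (((0 + 1 : ℕ) : ℤ) - (k + 1 : ℕ)) = ((0 : ℕ) : ℤ) - k by push_cast; ring, ih 0]
      simp [pow_succ]; ring
    · rw [show (((m + 1 + 1 : ℕ) : ℤ) - (k + 1 : ℕ)) = ((m + 1 : ℕ) : ℤ) - k by push_cast; ring,
        show (((m + 1 : ℕ) : ℤ) - k - 1) = (m : ℤ) - k by push_cast; ring, ih, ih]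
      rw [show 2 * (k + 1) = (2 * k + 1) + 1 by ring, Nat.choose_succ_succ, Nat.choose_succ_succ,
        Nat.choose_succ_succ]
      push_cast
      field_simp
      ring

lemma lazyKernel_zero_sq_le (k : ℕ) : lazyKernel ℤ k 0 ^ 2 * (2 * k + 1) ≤ 1 := by
  have h0 : ∀ k, lazyKernel ℤ k 0 = (k.centralBinom : ℝ) / 4 ^ k := fun k => by
    simpa [Nat.centralBinom] using lazyKernel_eq_choose k k
  induction k with
  | zero => simp [lazyKernel]
  | succ k ih =>
    have h1 : lazyKernel ℤ (k + 1) 0 = lazyKernel ℤ k 0 * ((2 * k + 1) / (2 * k + 2)) := by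
      rw [h0, h0]
      have := Nat.succ_mul_centralBinom_succ k
      have h2 : ((k : ℝ) + 1) * ((k + 1).centralBinom : ℝ) =
        2 * (2 * k + 1) * (k.centralBinom : ℝ) := by exact_mod_cast this
      field_simp
      rw [pow_succ]
      linear_combination (4 ^ k * 2) * h2
    rw [h1]
    push_cast
    refine le_trans ?_ ih
    have h3 : ((2 * (k : ℝ) + 1) / (2 * k + 2)) ^ 2 * (2 * (k + 1) + 1) ≤ 2 * k + 1 := by
      rw [div_pow, div_mul_eq_mul_div, div_le_iff₀ (by positivity)]
      nlinarith [(k.cast_nonneg : (0:ℝ) ≤ k)]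
    calc _ = lazyKernel ℤ k 0 ^ 2 * (((2 * (k : ℝ) + 1) / (2 * k + 2)) ^ 2 * (2 * (k + 1) + 1)) := by
          ring
      _ ≤ _ := by gcongr

lemma lazyKernel_zero_le (k : ℕ) : lazyKernel ℤ k 0 ≤ 1 / √((k : ℝ) + 1) := by
  rw [le_div_iff₀ (Real.sqrt_pos.2 (by positivity))]
  refine abs_le_of_sq_le_sq' ?_ zero_le_one |>.2
  rw [mul_pow, Real.sq_sqrt (by positivity), one_pow]
  refine le_trans ?_ (lazyKernel_zero_sq_le k)
  gcongr
  linarith [(k.cast_nonneg : (0:ℝ) ≤ k)]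

lemma hasSum_lazyKernel_exp (l : ℝ) (k : ℕ) :
    HasSum (fun z : ℤ => lazyKernel ℤ k z * Real.exp (l * z)) (((1 + Real.cosh l) / 2) ^ k) := by
  induction k with
  | zero =>
    rw [pow_zero]
    convert hasSum_ite_eq (0 : ℤ) (1 : ℝ) using 2 with z
    simp only [lazyKernel]; split_ifs with h <;> simp [h]
  | succ k ih =>
    have h1 := ((Equiv.subRight (1 : ℤ)).hasSum_iff.2 ih).mul_left (Real.exp l / 4)
    have h2 := ((Equiv.addRight (1 : ℤ)).hasSum_iff.2 ih).mul_left (Real.exp (-l) / 4)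
    have h3 : ((1 + Real.cosh l) / 2) ^ (k + 1) = Real.exp l / 4 * ((1 + Real.cosh l) / 2) ^ k +
        1 / 2 * ((1 + Real.cosh l) / 2) ^ k + Real.exp (-l) / 4 * ((1 + Real.cosh l) / 2) ^ k := by
      rw [pow_succ]; nth_rewrite 2 [Real.cosh_eq]; ring
    rw [h3]
    refine ((h1.add (ih.mul_left (1 / 2))).add h2).congr_fun ?_
    · intro z
      simp only [lazyKernel, Function.comp, Equiv.subRight_apply, Equiv.coe_addRight]
      push_cast
      have e1 : Real.exp l * Real.exp (l * (z - 1)) = Real.exp (l * z) := by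
        rw [← Real.exp_add]; ring_nf
      have e2 : Real.exp (-l) * Real.exp (l * (z + 1)) = Real.exp (l * z) := by
        rw [← Real.exp_add]; ring_nf
      linear_combination (-lazyKernel ℤ k (z - 1) / 4) * e1 - (lazyKernel ℤ k (z + 1) / 4) * e2

lemma hasSum_lazyKernel (k : ℕ) : HasSum (fun z : ℤ => lazyKernel ℤ k z) 1 := by
  simpa using hasSum_lazyKernel_exp 0 k

lemma hasSum_lazyKernel_cosh (l : ℝ) (k : ℕ) :
    HasSum (fun z : ℤ => lazyKernel ℤ k z * (Real.exp (l * z) + Real.exp (-l * z)))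
      (2 * ((1 + Real.cosh l) / 2) ^ k) := by
  convert (hasSum_lazyKernel_exp l k).add (hasSum_lazyKernel_exp (-l) k) using 1
  · ext z; ring
  · rw [Real.cosh_neg]; ring

lemma exp_mul_abs_le (l : ℝ) (z : ℤ) :
    Real.exp (l * |(z : ℝ)|) ≤ Real.exp (l * z) + Real.exp (-l * z) := by
  rcases abs_cases (z : ℝ) with ⟨h, _⟩ | ⟨h, _⟩ <;> rw [h]
  · linarith [Real.exp_pos (-l * z)]
  · rw [mul_neg, ← neg_mul]; linarith [Real.exp_pos (l * z)]

lemma one_le_exp_mul {l M : ℝ} (hl : 0 ≤ l) {z : ℤ} (h : M ≤ |(z : ℝ)|) :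
    1 ≤ Real.exp (-l * M) * (Real.exp (l * z) + Real.exp (-l * z)) := by
  calc (1 : ℝ) ≤ Real.exp (-l * M) * Real.exp (l * |(z : ℝ)|) := by
        rw [← Real.exp_add]; apply Real.one_le_exp; nlinarith
    _ ≤ _ := by gcongr; exact exp_mul_abs_le l z

lemma hasSum_lazyKernel_zmod (N : ℕ) [NeZero N] (k : ℕ) (a : ℤ) :
    HasSum (fun m : ℤ => lazyKernel ℤ k (a + N * m)) (lazyKernel (ZMod N) k (a : ZMod N)) := by
  induction k generalizing a with
  | zero =>
    have hN : (N : ℤ) ≠ 0 := by exact_mod_cast NeZero.ne N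
    simp only [lazyKernel]
    by_cases h : (a : ZMod N) = 0
    · rw [if_pos h]
      obtain ⟨c, hc⟩ := (ZMod.intCast_zmod_eq_zero_iff_dvd a N).1 h
      convert hasSum_ite_eq (-c) (1 : ℝ) using 3 with m
      rw [hc, ← mul_add, mul_eq_zero, or_iff_right hN, eq_neg_iff_add_eq_zero, add_comm]
    · rw [if_neg h]
      convert hasSum_zero using 2 with m
      rw [if_neg]
      intro h'
      apply h
      have := congrArg (Int.cast : ℤ → ZMod N) h'
      simpa using this
  | succ k ih =>
    simp only [lazyKernel]
    have h1 := ih (a - 1)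
    have h2 := ih (a + 1)
    push_cast at h1 h2
    refine (((h1.div_const 4).add ((ih a).div_const 2)).add (h2.div_const 4)).congr_fun
      fun m => ?_
    rw [sub_add_eq_add_sub, add_right_comm a 1]

end

section

lemma lazyKernel_le_zmod (N : ℕ) [NeZero N] (k : ℕ) (a : ℤ) :
    lazyKernel ℤ k a ≤ lazyKernel (ZMod N) k (a : ZMod N) := by
  have := (hasSum_lazyKernel_zmod N k a)
  simpa using this.summable.le_tsum 0 (fun m _ => lazyKernel_nonneg _ _) |>.trans_eq this.tsum_eq

lemma lazyKernel_zmod_le (N : ℕ) [NeZero N] (k : ℕ) {a : ℤ} (ha : |(a : ℝ)| ≤ N / 2) {l : ℝ}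
    (hl : 0 ≤ l) :
    lazyKernel (ZMod N) k (a : ZMod N) ≤
      lazyKernel ℤ k a + 2 * Real.exp (-l * (N / 2)) * ((1 + Real.cosh l) / 2) ^ k := by
  have hN : (0 : ℝ) < N := by exact_mod_cast NeZero.pos N
  set F : ℤ → ℝ := fun z => Real.exp (-l * (N / 2)) *
    (lazyKernel ℤ k z * (Real.exp (l * z) + Real.exp (-l * z))) with hF
  have hF0 : ∀ z, 0 ≤ F z := fun z =>
    mul_nonneg (Real.exp_pos _).le (mul_nonneg (lazyKernel_nonneg _ _) (by positivity))
  have hFs : HasSum F (Real.exp (-l * (N / 2)) * (2 * ((1 + Real.cosh l) / 2) ^ k)) :=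
    (hasSum_lazyKernel_cosh l k).mul_left _
  have hinj : Function.Injective fun m : ℤ => a + N * m := by
    intro m m' h
    have : (N : ℤ) ≠ 0 := by exact_mod_cast NeZero.ne N
    exact mul_left_cancel₀ this (add_left_cancel h)
  have hFc : Summable fun m : ℤ => F (a + N * m) := hFs.summable.comp_injective hinj
  have h1 := hasSum_lazyKernel_zmod N k a
  have h2 := (hasSum_ite_eq (0 : ℤ) (lazyKernel ℤ k a)).add hFc.hasSum
  have h3 : ∀ m : ℤ, lazyKernel ℤ k (a + N * m) ≤
      (if m = 0 then lazyKernel ℤ k a else 0) + F (a + N * m) := by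
    intro m
    split_ifs with hm
    · simp [hm, hF0]
    · rw [zero_add]
      have hfar : (N : ℝ) / 2 ≤ |((a + N * m : ℤ) : ℝ)| := by
        push_cast
        have hm1 : (1 : ℝ) ≤ |(m : ℝ)| := by exact_mod_cast Int.one_le_abs hm
        have h4 := abs_sub_abs_le_abs_sub ((N : ℝ) * m) (-a)
        rw [abs_mul, Nat.abs_cast, abs_neg, sub_neg_eq_add, add_comm _ (a : ℝ)] at h4
        nlinarith
      have := one_le_exp_mul hl hfar
      have h5 := mul_le_mul_of_nonneg_left this (lazyKernel_nonneg k (a + N * m))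
      simp only [hF]
      linarith
  have h4 := hasSum_le h3 h1 h2
  have h5 : ∑' m : ℤ, F (a + N * m) ≤ ∑' z, F z :=
    tsum_comp_le_tsum_of_inj hFs.summable hF0 hinj
  rw [hFs.tsum_eq] at h5
  linarith

lemma tsum_shift_le_of_antitone {f : ℤ → ℝ} (hf0 : ∀ z, 0 ≤ f z)
    (hf : ∀ z w : ℤ, |w| ≤ |z| → f z ≤ f w) {N : ℕ} {a b : ℤ} (ha0 : 0 ≤ a) (haN : a < N)
    (hb0 : 0 ≤ b) (hbN : b < N) {A B : ℝ} (hA : HasSum (fun m : ℤ => f (a + N * m)) A)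
    (hB : HasSum (fun m : ℤ => f (b + N * m)) B) : A ≤ B + 2 * f 0 := by
  have hfz : ∀ z, f z ≤ f 0 := fun z => hf z 0 (by simp)
  obtain ⟨u, hu⟩ : ∃ u : ℤ → ℝ, u = fun j => if 0 ≤ j then f (b + N * j) else 0 := ⟨_, rfl⟩
  obtain ⟨v, hv⟩ : ∃ v : ℤ → ℝ, v = fun j => if 0 ≤ j then 0 else f (b + N * j) := ⟨_, rfl⟩
  have hu0 : ∀ j, 0 ≤ u j := fun j => by rw [hu]; dsimp only; split_ifs; exacts [hf0 _, le_rfl]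
  have hv0 : ∀ j, 0 ≤ v j := fun j => by rw [hv]; dsimp only; split_ifs; exacts [le_rfl, hf0 _]
  have huv' : ∀ j, u j + v j = f (b + N * j) := fun j => by
    rw [hu, hv]; dsimp only; split_ifs <;> simp
  have hus : Summable u := hB.summable.of_nonneg_of_le hu0 fun j => by
    linarith [huv' j, hv0 j]
  have hvs : Summable v := hB.summable.of_nonneg_of_le hv0 fun j => by
    linarith [huv' j, hu0 j]
  have huv : ∑' j, u j + ∑' j, v j = B := by
    rw [← hus.tsum_add hvs, ← hB.tsum_eq]
    exact tsum_congr huv'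
  have h1 : HasSum (fun m => u (m - 1)) (∑' j, u j) :=
    (Equiv.subRight (1 : ℤ)).hasSum_iff.2 hus.hasSum
  have h2 : HasSum (fun m => v (m + 1)) (∑' j, v j) :=
    (Equiv.addRight (1 : ℤ)).hasSum_iff.2 hvs.hasSum
  have h3 := ((hasSum_ite_eq (0 : ℤ) (f 0)).add (hasSum_ite_eq (-1 : ℤ) (f 0))).add (h1.add h2)
  have hle : ∀ m : ℤ, f (a + N * m) ≤ ((if m = 0 then f 0 else 0) + (if m = -1 then f 0 else 0)) +
      (u (m - 1) + v (m + 1)) := by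
    intro m
    have hu1 := hu0 (m - 1)
    have hv1 := hv0 (m + 1)
    have hm' := hfz (a + N * m)
    by_cases hm0 : m = 0
    · rw [if_pos hm0, if_neg (by omega)]
      linarith
    by_cases hm1 : m = -1
    · rw [if_neg hm0, if_pos hm1]
      linarith
    rw [if_neg hm0, if_neg hm1]
    rcases lt_or_gt_of_ne hm0 with hm | hm
    · have hv2 : v (m + 1) = f (b + N * (m + 1)) := by
        rw [hv]; dsimp only; rw [if_neg (by omega)]
      have : f (a + N * m) ≤ f (b + N * (m + 1)) := by
        refine hf _ _ ?_
        have h5 : (N : ℤ) * (m + 1) ≤ N * (-1) := by gcongr; omega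
        rw [mul_add] at h5
        rw [mul_add, abs_of_nonpos (by linarith), abs_of_nonpos (by linarith)]
        linarith
      linarith
    · have hv2 : u (m - 1) = f (b + N * (m - 1)) := by
        rw [hu]; dsimp only; rw [if_pos (by omega)]
      have : f (a + N * m) ≤ f (b + N * (m - 1)) := by
        refine hf _ _ ?_
        have h5 : (0 : ℤ) ≤ N * (m - 1) := by
          apply mul_nonneg <;> omega
        rw [mul_sub] at h5
        rw [mul_sub, abs_of_nonneg (by linarith), abs_of_nonneg (by linarith)]
        linarith
      linarith
  have := hasSum_le hle hA h3
  linarith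

lemma lazyKernel_zmod_sub_le (N : ℕ) [NeZero N] (k : ℕ) (x y : ZMod N) :
    lazyKernel (ZMod N) k x ≤ lazyKernel (ZMod N) k y + 2 * lazyKernel ℤ k 0 := by
  have hx : ((x.val : ℤ) : ZMod N) = x := by simp
  have hy : ((y.val : ℤ) : ZMod N) = y := by simp
  have hA := hasSum_lazyKernel_zmod N k x.val
  have hB := hasSum_lazyKernel_zmod N k y.val
  rw [hx] at hA
  rw [hy] at hB
  exact tsum_shift_le_of_antitone (lazyKernel_nonneg k) (fun z w h => lazyKernel_le_of_abs_le k h)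
    (by positivity) (by exact_mod_cast x.val_lt) (by positivity) (by exact_mod_cast y.val_lt) hA hB

lemma abs_lazyKernel_zmod_sub_le (N : ℕ) [NeZero N] (k : ℕ) (x : ZMod N) :
    |lazyKernel (ZMod N) k x - 1 / N| ≤ 2 * lazyKernel ℤ k 0 := by
  have hN : (0 : ℝ) < N := by exact_mod_cast NeZero.pos N
  have hs := sum_lazyKernel (R := ZMod N) k
  have h1 : ∑ y : ZMod N, lazyKernel (ZMod N) k x ≤
      ∑ y : ZMod N, (lazyKernel (ZMod N) k y + 2 * lazyKernel ℤ k 0) :=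
    Finset.sum_le_sum fun y _ => lazyKernel_zmod_sub_le N k x y
  have h2 : ∑ y : ZMod N, lazyKernel (ZMod N) k y ≤
      ∑ y : ZMod N, (lazyKernel (ZMod N) k x + 2 * lazyKernel ℤ k 0) :=
    Finset.sum_le_sum fun y _ => lazyKernel_zmod_sub_le N k y x
  simp only [Finset.sum_add_distrib, hs, Finset.sum_const, Finset.card_univ, ZMod.card,
    nsmul_eq_mul] at h1 h2
  rw [abs_le]
  constructor
  · have : 1 / (N : ℝ) ≤ lazyKernel (ZMod N) k x + 2 * lazyKernel ℤ k 0 := by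
      rw [div_le_iff₀ hN]; linarith
    linarith
  · have : lazyKernel (ZMod N) k x - 2 * lazyKernel ℤ k 0 ≤ 1 / N := by
      rw [le_div_iff₀ hN]; linarith
    linarith

/-- The transition kernel at time `s` of the continuous-time simple random walk on `R` with jump
rate `1`. -/
def lineKernel (R : Type*) [Ring R] [DecidableEq R] (s : ℝ) (z : R) : ℝ :=
  poissonMean (2 * s) fun k => lazyKernel R k z

section general
variable {R : Type*} [Ring R] [DecidableEq R]

lemma lineKernel_nonneg {s : ℝ} (hs : 0 ≤ s) (z : R) : 0 ≤ lineKernel R s z :=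
  poissonMean_nonneg (by positivity) fun k => lazyKernel_nonneg k z

lemma expBounded_const (C : ℝ) : ExpBounded fun _ => C := .of_abs_le fun _ => le_rfl

lemma lineKernel_le_one {s : ℝ} (hs : 0 ≤ s) (z : R) : lineKernel R s z ≤ 1 :=
  (poissonMean_mono (expBounded_lazyKernel z) (expBounded_const 1) (by positivity)
    fun k => lazyKernel_le_one k z).trans_eq (poissonMean_const 1 _)

lemma lineKernel_zero (z : R) : lineKernel R 0 z = if z = 0 then 1 else 0 := by
  simp [lineKernel, poissonMean_zero, lazyKernel]

lemma hasDerivAt_lineKernel (s : ℝ) (z : R) :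
    HasDerivAt (fun s => lineKernel R s z)
      ((lineKernel R s (z - 1) + lineKernel R s (z + 1)) / 2 - lineKernel R s z) s := by
  have h := (hasDerivAt_poissonMean (abs_lazyKernel_le z) (2 * s)).comp s
    ((hasDerivAt_id s).const_mul 2)
  refine HasDerivAt.congr_deriv h ?_
  have h1 := expBounded_lazyKernel (R := R)
  have h2 : (fun k => lazyKernel R (k + 1) z) = fun k => (1 / 4 * lazyKernel R k (z - 1) +
      1 / 2 * lazyKernel R k z) + 1 / 4 * lazyKernel R k (z + 1) := by
    funext k; simp only [lazyKernel]; ring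
  rw [h2, poissonMean_add (((h1 _).const_mul _).add ((h1 _).const_mul _)) ((h1 _).const_mul _),
    poissonMean_add ((h1 _).const_mul _) ((h1 _).const_mul _)]
  simp only [poissonMean_const_mul, lineKernel]
  ring

lemma sum_lineKernel [Fintype R] (s : ℝ) : ∑ z : R, lineKernel R s z = 1 := by
  simp only [lineKernel]
  rw [← poissonMean_finset_sum _ _ fun z _ => expBounded_lazyKernel z]
  simp only [sum_lazyKernel]
  exact poissonMean_const 1 _

end general

lemma lineKernel_le_sqrt {s : ℝ} (hs : 0 < s) (z : ℤ) : lineKernel ℤ s z ≤ 1 / √s := by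
  refine (poissonMean_le_one_div_sqrt (fun k => lazyKernel_nonneg k z) (fun k =>
    (lazyKernel_le_of_abs_le k (by simp)).trans (lazyKernel_zero_le k))
    (by positivity : 0 < 2 * s)).trans ?_
  gcongr
  linarith

lemma lineKernel_le_zmod (N : ℕ) [NeZero N] {s : ℝ} (hs : 0 ≤ s) (a : ℤ) :
    lineKernel ℤ s a ≤ lineKernel (ZMod N) s (a : ZMod N) :=
  poissonMean_mono (expBounded_lazyKernel _) (expBounded_lazyKernel _) (by positivity)
    fun k => lazyKernel_le_zmod N k a

lemma lineKernel_zmod_le (N : ℕ) [NeZero N] {s : ℝ} (hs : 0 ≤ s) {a : ℤ}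
    (ha : |(a : ℝ)| ≤ N / 2) {l : ℝ} (hl : 0 ≤ l) :
    lineKernel (ZMod N) s (a : ZMod N) ≤
      lineKernel ℤ s a + 2 * Real.exp (-l * (N / 2) + s * (Real.cosh l - 1)) := by
  have h1 := expBounded_lazyKernel (R := ℤ) a
  have h2 := ExpBounded.const_mul_pow (2 * Real.exp (-l * (N / 2))) ((1 + Real.cosh l) / 2)
  refine (poissonMean_mono (expBounded_lazyKernel _) (h1.add h2) (by positivity)
    fun k => lazyKernel_zmod_le N k ha hl).trans_eq ?_
  rw [poissonMean_add h1 h2, poissonMean_pow, lineKernel, mul_assoc 2, ← Real.exp_add]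
  ring_nf

lemma abs_lineKernel_zmod_sub_le (N : ℕ) [NeZero N] {s : ℝ} (hs : 0 < s) (x : ZMod N) :
    |lineKernel (ZMod N) s x - 1 / N| ≤ 2 / √s := by
  have h0 := expBounded_lazyKernel (0 : ℤ)
  have h1 := expBounded_lazyKernel x
  have h2 : lineKernel ℤ s 0 ≤ 1 / √s := lineKernel_le_sqrt hs 0
  have h3 : lineKernel (ZMod N) s x ≤ 1 / N + 2 * lineKernel ℤ s 0 := by
    refine (poissonMean_mono h1 ((expBounded_const (1 / (N : ℝ))).add (h0.const_mul 2))
      (by positivity) fun k => ?_).trans_eq ?_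
    · linarith [(abs_le.1 (abs_lazyKernel_zmod_sub_le N k x)).2]
    · rw [poissonMean_add (expBounded_const _) (h0.const_mul 2), poissonMean_const,
        poissonMean_const_mul]; rfl
  have h4 : 1 / (N : ℝ) ≤ lineKernel (ZMod N) s x + 2 * lineKernel ℤ s 0 := by
    refine (poissonMean_const (1 / (N : ℝ)) (2 * s)).symm.trans_le
      ((poissonMean_mono (expBounded_const _) (h1.add (h0.const_mul 2))
      (by positivity) fun k => ?_).trans_eq ?_)
    · linarith [(abs_le.1 (abs_lazyKernel_zmod_sub_le N k x)).1]
    · rw [poissonMean_add h1 (h0.const_mul 2), poissonMean_const_mul]; rfl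
  have h5 : 2 / √s = 2 * (1 / √s) := by ring
  rw [abs_le, h5]
  constructor <;> linarith

lemma lineKernel_le_exp {s : ℝ} (hs : 0 ≤ s) (z : ℤ) :
    lineKernel ℤ s z ≤ 2 * Real.exp (-|(z : ℝ)| + s * (Real.cosh 1 - 1)) := by
  have h2 := ExpBounded.const_mul_pow (2 * Real.exp (-|(z : ℝ)|)) ((1 + Real.cosh 1) / 2)
  refine (poissonMean_mono (expBounded_lazyKernel _) h2 (by positivity) fun k => ?_).trans_eq ?_
  · have h1 := (hasSum_lazyKernel_cosh 1 k).summable.le_tsum z fun m _ =>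
      mul_nonneg (lazyKernel_nonneg _ _) (by positivity)
    rw [(hasSum_lazyKernel_cosh 1 k).tsum_eq] at h1
    have h3 := one_le_exp_mul zero_le_one (le_refl |(z : ℝ)|)
    have h4 := mul_le_mul_of_nonneg_left h3 (lazyKernel_nonneg k z)
    rw [neg_one_mul] at h4
    calc lazyKernel ℤ k z ≤ Real.exp (-|(z : ℝ)|) *
          (lazyKernel ℤ k z * (Real.exp (1 * z) + Real.exp (-1 * z))) := by linarith
      _ ≤ Real.exp (-|(z : ℝ)|) * (2 * ((1 + Real.cosh 1) / 2) ^ k) := by gcongr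
      _ = _ := by ring
  · rw [poissonMean_pow, mul_assoc 2, ← Real.exp_add]
    ring_nf

lemma one_sub_le_sum_lineKernel {s : ℝ} (hs : 0 ≤ s) (M : ℕ) {l : ℝ} (hl : 0 ≤ l) :
    1 - 2 * Real.exp (-l * M + s * (Real.cosh l - 1)) ≤
      ∑ z ∈ Finset.Icc (-(M : ℤ)) M, lineKernel ℤ s z := by
  have h2 := ExpBounded.const_mul_pow (2 * Real.exp (-l * M)) ((1 + Real.cosh l) / 2)
  have h1 := ExpBounded.finset_sum (Finset.Icc (-(M : ℤ)) M) fun z _ => expBounded_lazyKernel z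
  have key : ∀ k, (1 : ℝ) ≤ ∑ z ∈ Finset.Icc (-(M : ℤ)) M, lazyKernel ℤ k z +
      2 * Real.exp (-l * M) * ((1 + Real.cosh l) / 2) ^ k := by
    intro k
    have h3 := hasSum_sum_of_ne_finset_zero (L := .unconditional ℤ) (f := Set.indicator (Finset.Icc (-(M : ℤ)) M : Set ℤ)
      (lazyKernel ℤ k)) (s := Finset.Icc (-(M : ℤ)) M) fun z hz => by
        rw [Set.indicator_of_notMem]; exact_mod_cast hz
    have h4 := h3.add ((hasSum_lazyKernel_cosh l k).mul_left (Real.exp (-l * M)))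
    have h5 := hasSum_le (fun z => ?_) (hasSum_lazyKernel k) h4
    · refine h5.trans_eq ?_
      congr 1
      · refine Finset.sum_congr rfl fun z hz => ?_
        rw [Set.indicator_of_mem]; exact_mod_cast hz
      · ring
    · by_cases hz : z ∈ Finset.Icc (-(M : ℤ)) M
      · rw [Set.indicator_of_mem (by exact_mod_cast hz)]
        have : 0 ≤ Real.exp (-l * M) * (lazyKernel ℤ k z * (Real.exp (l * z) +
          Real.exp (-l * z))) := mul_nonneg (by positivity)
            (mul_nonneg (lazyKernel_nonneg _ _) (by positivity))
        linarith
      · rw [Set.indicator_of_notMem (by exact_mod_cast hz), zero_add]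
        have hz' : (M : ℝ) ≤ |(z : ℝ)| := by
          have : (M : ℤ) ≤ |z| := by
            rw [Finset.mem_Icc, ← abs_le] at hz; omega
          exact_mod_cast this
        have h6 := mul_le_mul_of_nonneg_left (one_le_exp_mul hl hz') (lazyKernel_nonneg k z)
        linarith
  have h3 := (poissonMean_const 1 (2 * s)).symm.trans_le
    (poissonMean_mono (expBounded_const 1) (h1.add h2) (by positivity) key)
  rw [poissonMean_add h1 h2, poissonMean_pow, mul_assoc 2, ← Real.exp_add,
    poissonMean_finset_sum _ _ fun z _ => expBounded_lazyKernel z] at h3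
  have h4 : -l * (M : ℝ) + s * (Real.cosh l - 1) = -l * M + 2 * s * ((1 + Real.cosh l) / 2 - 1) := by
    ring
  rw [h4]
  simp only [lineKernel]
  linarith

end

section

/-- The mean of `f` over the `2d` neighbours of `x`. -/
def stepMean {d : ℕ} {R : Type*} [Ring R] (f : (Fin d → R) → ℝ) (x : Fin d → R) : ℝ :=
  (∑ s : Fin d × Bool, f (x + unitStep R s)) / (2 * d)

/-- The transition kernel at time `t` of the continuous-time simple random walk on `R ^ d`: the
coordinates are independent walks on `R` with jump rate `1 / d`. -/
def walkKernel {d : ℕ} (R : Type*) [Ring R] [DecidableEq R] (t : ℝ) (z : Fin d → R) : ℝ :=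
  ∏ i, lineKernel R (t / d) (z i)

section general
variable {d : ℕ} {R : Type*} [Ring R]

lemma stepMean_eq_sum (f : (Fin d → R) → ℝ) (x : Fin d → R) :
    stepMean f x = (∑ i : Fin d, (f (x + Pi.single i 1) + f (x + Pi.single i (-1)))) / (2 * d) := by
  simp [stepMean, unitStep, Fintype.sum_prod_type]

lemma stepMean_const_mul (c : ℝ) (f : (Fin d → R) → ℝ) (x : Fin d → R) :
    stepMean (fun y => c * f y) x = c * stepMean f x := by
  simp only [stepMean, ← Finset.mul_sum, mul_div_assoc]

lemma stepMean_sub (f g : (Fin d → R) → ℝ) (x : Fin d → R) :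
    stepMean (fun y => f y - g y) x = stepMean f x - stepMean g x := by
  simp only [stepMean, Finset.sum_sub_distrib, sub_div]

lemma stepMean_finset_sum {ι : Type*} (S : Finset ι) (f : ι → (Fin d → R) → ℝ) (x : Fin d → R) :
    stepMean (fun y => ∑ j ∈ S, f j y) x = ∑ j ∈ S, stepMean (f j) x := by
  simp only [stepMean]
  rw [Finset.sum_comm, Finset.sum_div]

lemma stepMean_comp_sub (f : (Fin d → R) → ℝ) (x y : Fin d → R) :
    stepMean (fun x => f (x - y)) x = stepMean f (x - y) := by
  simp only [stepMean, sub_add_eq_add_sub]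

lemma stepMean_const (hd : 0 < d) (c : ℝ) (x : Fin d → R) : stepMean (fun _ => c) x = c := by
  have : (d : ℝ) ≠ 0 := by positivity
  simp only [stepMean, Finset.sum_const, Finset.card_univ, Fintype.card_prod, Fintype.card_fin,
    Fintype.card_bool, nsmul_eq_mul]
  push_cast
  field_simp

lemma stepMean_mono {f g : (Fin d → R) → ℝ} (h : ∀ y, f y ≤ g y) (x : Fin d → R) :
    stepMean f x ≤ stepMean g x := by
  unfold stepMean
  gcongr
  exact h _

lemma stepMean_le {f : (Fin d → R) → ℝ} {c : ℝ} (hd : 0 < d) (h : ∀ y, f y ≤ c)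
    (x : Fin d → R) : stepMean f x ≤ c :=
  (stepMean_mono h x).trans_eq (stepMean_const hd c x)

lemma stepMean_nonneg {f : (Fin d → R) → ℝ} (h : ∀ y, 0 ≤ f y) (x : Fin d → R) :
    0 ≤ stepMean f x := div_nonneg (Finset.sum_nonneg fun _ _ => h _) (by positivity)

lemma sum_mul_stepMean [Fintype R] (f g : (Fin d → R) → ℝ) :
    ∑ x, stepMean f x * g x = ∑ x, f x * stepMean g x := by
  have h1 : ∀ i : Fin d, ∀ a : R, ∑ x, f (x + Pi.single i a) * g x =
      ∑ x, f x * g (x + Pi.single i (-a)) := by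
    intro i a
    have := Equiv.sum_comp (Equiv.addRight (Pi.single i a : Fin d → R))
      fun x => f x * g (x + Pi.single i (-a))
    rw [← this]
    simp [add_assoc, ← Pi.single_add]
  simp only [stepMean_eq_sum, div_mul_eq_mul_div, mul_div_assoc', ← Finset.sum_div,
    Finset.sum_mul, Finset.mul_sum]
  rw [Finset.sum_comm, Finset.sum_comm (f := fun x i => f x * _)]
  congr 1
  refine Finset.sum_congr rfl fun i _ => ?_
  simp only [add_mul, mul_add, Finset.sum_add_distrib]
  rw [h1, h1, neg_neg, add_comm]

variable [DecidableEq R]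

lemma walkKernel_nonneg {t : ℝ} (ht : 0 ≤ t) (z : Fin d → R) : 0 ≤ walkKernel R t z :=
  Finset.prod_nonneg fun _ _ => lineKernel_nonneg (by positivity) _

lemma walkKernel_le_one {t : ℝ} (ht : 0 ≤ t) (z : Fin d → R) : walkKernel R t z ≤ 1 :=
  Finset.prod_le_one (fun _ _ => lineKernel_nonneg (by positivity) _)
    fun _ _ => lineKernel_le_one (by positivity) _

lemma walkKernel_le_lineKernel {t : ℝ} (ht : 0 ≤ t) (z : Fin d → R) (i : Fin d) :
    walkKernel R t z ≤ lineKernel R (t / d) (z i) := by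
  unfold walkKernel
  rw [← Finset.mul_prod_erase _ _ (Finset.mem_univ i)]
  exact mul_le_of_le_one_right (lineKernel_nonneg (by positivity) _)
    (Finset.prod_le_one (fun _ _ => lineKernel_nonneg (by positivity) _)
      fun _ _ => lineKernel_le_one (by positivity) _)

lemma walkKernel_zero (z : Fin d → R) : walkKernel R 0 z = if z = 0 then 1 else 0 := by
  simp only [walkKernel, zero_div, lineKernel_zero, Finset.prod_ite_zero, Finset.prod_const_one]
  congr 1
  simp [funext_iff]

lemma walkKernel_add_single (t : ℝ) (z : Fin d → R) (i : Fin d) (a : R) :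
    walkKernel R t (z + Pi.single i a) =
      (∏ j ∈ Finset.univ.erase i, lineKernel R (t / d) (z j)) * lineKernel R (t / d) (z i + a) := by
  unfold walkKernel
  rw [← Finset.prod_erase_mul _ _ (Finset.mem_univ i)]
  congr 1
  · refine Finset.prod_congr rfl fun j hj => ?_
    rw [Pi.add_apply, Pi.single_eq_of_ne (Finset.ne_of_mem_erase hj), add_zero]
  · simp

lemma hasDerivAt_walkKernel (hd : 0 < d) (t : ℝ) (z : Fin d → R) :
    HasDerivAt (fun t => walkKernel R t z)
      (stepMean (walkKernel R t) z - walkKernel R t z) t := by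
  have hd' : (d : ℝ) ≠ 0 := by positivity
  have h := HasDerivAt.fun_finsetProd (u := Finset.univ)
    (f := fun (i : Fin d) (t : ℝ) => lineKernel R (t / d) (z i)) (x := t)
    (f' := fun i => ((lineKernel R (t / d) (z i - 1) + lineKernel R (t / d) (z i + 1)) / 2 -
      lineKernel R (t / d) (z i)) * (1 / d))
    fun i _ => HasDerivAt.comp (h₂ := fun s => lineKernel R s (z i)) t
      (hasDerivAt_lineKernel (t / d) (z i)) ((hasDerivAt_id t).div_const (d : ℝ))
  refine HasDerivAt.congr_deriv h ?_
  have h2 : walkKernel R t z = (∑ i : Fin d, walkKernel R t z) / d := by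
    simp; field_simp
  rw [stepMean_eq_sum, h2, ← mul_div_mul_left (∑ i : Fin d, walkKernel R t z) _ two_ne_zero,
    ← sub_div, Finset.mul_sum, ← Finset.sum_sub_distrib, Finset.sum_div]
  refine Finset.sum_congr rfl fun i _ => ?_
  have h3 := walkKernel_add_single t z i 0
  rw [Pi.single_zero, add_zero, add_zero] at h3
  rw [walkKernel_add_single, walkKernel_add_single, h3, ← sub_eq_add_neg]
  simp only [smul_eq_mul]
  field_simp
  ring

lemma continuous_walkKernel (hd : 0 < d) (z : Fin d → R) :
    Continuous fun t => walkKernel R t z :=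
  continuous_iff_continuousAt.2 fun t => (hasDerivAt_walkKernel hd t z).continuousAt

lemma sum_walkKernel [Fintype R] (t : ℝ) : ∑ z : Fin d → R, walkKernel R t z = 1 := by
  have := Finset.prod_univ_sum (fun _ : Fin d => (Finset.univ : Finset R))
    fun _ a => lineKernel R (t / d) a
  simp only [sum_lineKernel, Finset.prod_const_one, Fintype.piFinset_univ] at this
  exact this.symm

end general

lemma walkKernel_le_exp {d : ℕ} {t : ℝ} (ht : 0 ≤ t) (z : Fin d → ℤ) (i : Fin d) :
    walkKernel ℤ t z ≤ 2 * Real.exp (-|(z i : ℝ)| + t / d * (Real.cosh 1 - 1)) :=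
  (walkKernel_le_lineKernel ht z i).trans (lineKernel_le_exp (by positivity) _)

lemma walkKernel_le_rpow {d : ℕ} (hd : 0 < d) {t : ℝ} (ht : 0 < t) (z : Fin d → ℤ) :
    walkKernel ℤ t z ≤ (d : ℝ) ^ ((d : ℝ) / 2) * t ^ (-((d : ℝ) / 2)) := by
  have hd' : (0 : ℝ) < d := by positivity
  calc walkKernel ℤ t z ≤ ∏ _i : Fin d, 1 / √(t / d) :=
        Finset.prod_le_prod (fun _ _ => lineKernel_nonneg (by positivity) _)
          fun _ _ => lineKernel_le_sqrt (by positivity) _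
    _ = (d : ℝ) ^ ((d : ℝ) / 2) * t ^ (-((d : ℝ) / 2)) := by
      rw [Finset.prod_const, Finset.card_univ, Fintype.card_fin, Real.sqrt_eq_rpow, one_div,
        ← Real.rpow_neg (by positivity), ← Real.rpow_natCast, ← Real.rpow_mul (by positivity),
        Real.div_rpow ht.le hd'.le, show -(1 / 2 : ℝ) * d = -((d : ℝ) / 2) by ring,
        Real.rpow_neg hd'.le ((d : ℝ) / 2)]
      field_simp

lemma abs_prod_sub_one_le {ι : Type*} (S : Finset ι) (a : ι → ℝ) {η : ℝ} (hη : 0 ≤ η)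
    (h : ∀ i ∈ S, |a i - 1| ≤ η) : |∏ i ∈ S, a i - 1| ≤ (1 + η) ^ S.card - 1 := by
  classical
  induction S using Finset.induction_on with
  | empty => simp
  | insert i S hi ih =>
    rw [Finset.prod_insert hi, Finset.card_insert_of_notMem hi]
    have h1 := ih fun j hj => h j (by simp [hj])
    have h2 := h i (by simp)
    have h3 : |a i| ≤ 1 + η := by
      have := abs_add_le (a i - 1) 1
      simp at this; linarith
    calc |a i * ∏ j ∈ S, a j - 1| = |a i * (∏ j ∈ S, a j - 1) + (a i - 1)| := by congr 1; ring
      _ ≤ |a i| * |∏ j ∈ S, a j - 1| + |a i - 1| := by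
        rw [← abs_mul]; exact abs_add_le _ _
      _ ≤ (1 + η) * ((1 + η) ^ S.card - 1) + η := by gcongr
      _ = _ := by ring

lemma one_add_pow_sub_one_le {η : ℝ} (hη : 0 ≤ η) (hη1 : η ≤ 1) (n : ℕ) :
    (1 + η) ^ n - 1 ≤ 2 ^ n * η := by
  induction n with
  | zero => simpa using hη
  | succ n ih =>
    have h1 : (1 + η) ^ n ≤ 2 ^ n := by gcongr; linarith
    have h2 : (1 + η) ^ (n + 1) - 1 = ((1 + η) ^ n - 1) + η * (1 + η) ^ n := by ring
    rw [h2, pow_succ]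
    nlinarith

lemma abs_walkKernel_zmod_sub_le {d N : ℕ} [NeZero N] (hd : 0 < d) {t : ℝ} (ht : 0 < t)
    (hη : 2 * N / √(t / d) ≤ 1) (z : Torus d N) :
    |(N : ℝ) ^ d * walkKernel (ZMod N) t z - 1| ≤ 2 ^ d * (2 * N / √(t / d)) := by
  have hN : (0 : ℝ) < N := by exact_mod_cast NeZero.pos N
  have hη0 : 0 ≤ 2 * (N : ℝ) / √(t / d) := by positivity
  have h1 : (N : ℝ) ^ d * walkKernel (ZMod N) t z =
      ∏ i, ((N : ℝ) * lineKernel (ZMod N) (t / d) (z i)) := by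
    rw [Finset.prod_mul_distrib, Finset.prod_const, Finset.card_univ, Fintype.card_fin]; rfl
  rw [h1]
  refine (abs_prod_sub_one_le Finset.univ _ hη0 fun i _ => ?_).trans ?_
  · have := abs_lineKernel_zmod_sub_le N (by positivity : 0 < t / d) (z i)
    have h2 : (N : ℝ) * lineKernel (ZMod N) (t / d) (z i) - 1 =
        N * (lineKernel (ZMod N) (t / d) (z i) - 1 / N) := by field_simp
    rw [h2, abs_mul, Nat.abs_cast]
    calc _ ≤ (N : ℝ) * (2 / √(t / d)) := by gcongr
      _ = _ := by ring
  · rw [Finset.card_univ, Fintype.card_fin]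
    exact one_add_pow_sub_one_le hη0 hη d

lemma walkKernel_zmod_le {d N : ℕ} [NeZero N] (hd : 0 < d) {t : ℝ} (ht : 0 < t)
    (z : Torus d N) : walkKernel (ZMod N) t z ≤ (1 / N + 2 / √(t / d)) ^ d := by
  refine (Finset.prod_le_prod (g := fun _ => 1 / (N : ℝ) + 2 / √(t / d))
    (fun _ _ => lineKernel_nonneg (by positivity) _)
    fun i _ => ?_).trans_eq (by simp)
  linarith [(abs_le.1 (abs_lineKernel_zmod_sub_le N (by positivity : 0 < t / d) (z i))).2]

lemma walkKernel_le_zmod {d N : ℕ} [NeZero N] {t : ℝ} (ht : 0 ≤ t) (z : Fin d → ℤ) :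
    walkKernel ℤ t z ≤ walkKernel (ZMod N) t fun i => (z i : ZMod N) :=
  Finset.prod_le_prod (fun _ _ => lineKernel_nonneg (by positivity) _)
    fun _ _ => lineKernel_le_zmod N (by positivity) _

lemma prod_le_prod_add_card_mul {ι : Type*} (S : Finset ι) (a b : ι → ℝ) {η : ℝ} (hη : 0 ≤ η)
    (ha : ∀ i ∈ S, 0 ≤ a i) (hb0 : ∀ i ∈ S, 0 ≤ b i) (hb1 : ∀ i ∈ S, b i ≤ 1)
    (ha1 : ∀ i ∈ S, a i ≤ 1)
    (h : ∀ i ∈ S, b i ≤ a i + η) : ∏ i ∈ S, b i ≤ ∏ i ∈ S, a i + S.card * η := by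
  classical
  induction S using Finset.induction_on with
  | empty => simp
  | insert i S hi ih =>
    rw [Finset.prod_insert hi, Finset.prod_insert hi, Finset.card_insert_of_notMem hi]
    have h1 := ih (fun j hj => ha j (by simp [hj])) (fun j hj => hb0 j (by simp [hj]))
      (fun j hj => hb1 j (by simp [hj])) (fun j hj => ha1 j (by simp [hj]))
      (fun j hj => h j (by simp [hj]))
    have hB : ∏ j ∈ S, b j ≤ 1 := Finset.prod_le_one (fun j hj => hb0 j (by simp [hj]))
      (fun j hj => hb1 j (by simp [hj]))
    have hB0 : 0 ≤ ∏ j ∈ S, b j := Finset.prod_nonneg (fun j hj => hb0 j (by simp [hj]))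
    have h2 := h i (by simp)
    have h3 := ha i (by simp)
    have h4 := ha1 i (by simp)
    push_cast
    calc b i * ∏ j ∈ S, b j ≤ (a i + η) * ∏ j ∈ S, b j := by gcongr
      _ = a i * ∏ j ∈ S, b j + η * ∏ j ∈ S, b j := by ring
      _ ≤ a i * (∏ j ∈ S, a j + S.card * η) + η * 1 := by gcongr
      _ = a i * ∏ j ∈ S, a j + a i * (S.card * η) + η := by ring
      _ ≤ a i * ∏ j ∈ S, a j + 1 * (S.card * η) + η := by gcongr
      _ = _ := by ring

lemma walkKernel_zmod_le_add {d N : ℕ} [NeZero N] {t : ℝ} (ht : 0 ≤ t) {z : Fin d → ℤ}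
    (hz : ∀ i, |(z i : ℝ)| ≤ N / 2) {l : ℝ} (hl : 0 ≤ l) :
    walkKernel (ZMod N) t (fun i => (z i : ZMod N)) ≤ walkKernel ℤ t z +
      d * (2 * Real.exp (-l * (N / 2) + t / d * (Real.cosh l - 1))) := by
  have := prod_le_prod_add_card_mul Finset.univ (fun i => lineKernel ℤ (t / d) (z i))
    (fun i => lineKernel (ZMod N) (t / d) (z i : ZMod N))
    (η := 2 * Real.exp (-l * (N / 2) + t / d * (Real.cosh l - 1))) (by positivity)
    (fun _ _ => lineKernel_nonneg (by positivity) _)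
    (fun _ _ => lineKernel_nonneg (by positivity) _)
    (fun _ _ => lineKernel_le_one (by positivity) _)
    (fun _ _ => lineKernel_le_one (by positivity) _)
    (fun i _ => lineKernel_zmod_le N (by positivity) (hz i) hl)
  simpa [walkKernel] using this

/-- The closed ball of radius `M` around `0` in the `ℓ_∞`-distance of the lattice. -/
def latticeBox (d : ℕ) (M : ℕ) : Finset (Lattice d) :=
  Fintype.piFinset fun _ => Finset.Icc (-(M : ℤ)) M

lemma mem_latticeBox {d M : ℕ} {z : Lattice d} : z ∈ latticeBox d M ↔ ∀ i, |z i| ≤ M := by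
  simp [latticeBox, abs_le]

lemma card_latticeBox (d M : ℕ) : (latticeBox d M).card = (2 * M + 1) ^ d := by
  simp only [latticeBox, Fintype.card_piFinset, Int.card_Icc, Finset.prod_const, Finset.card_univ,
    Fintype.card_fin]
  congr 1
  omega

lemma cosh_sub_one_le {l : ℝ} (hl : |l| ≤ 1) : Real.cosh l - 1 ≤ l ^ 2 := by
  have h1 := Real.cosh_le_exp_half_sq l
  have h0 : l ^ 2 ≤ 1 := by rw [← sq_abs]; exact pow_le_one₀ (abs_nonneg _) hl
  have h2 := Real.exp_bound_div_one_sub_of_interval (x := l ^ 2 / 2) (by positivity) (by linarith)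
  have h3 : 1 / (1 - l ^ 2 / 2) ≤ 1 + l ^ 2 := by
    rw [div_le_iff₀ (by linarith)]
    nlinarith [sq_nonneg l]
  linarith

lemma half_pow_le_sum_walkKernel {d : ℕ} (hd : 0 < d) {M : ℕ} (hM : 2 ≤ M) {t : ℝ} (ht : 0 ≤ t)
    (htM : t ≤ (M : ℝ) ^ 2 / 36) :
    (1 / 2 : ℝ) ^ d ≤ ∑ z ∈ latticeBox d M, walkKernel ℤ t z := by
  have h := Finset.prod_univ_sum (fun _ : Fin d => Finset.Icc (-(M : ℤ)) M)
    fun _ a => lineKernel ℤ (t / d) a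
  have h1 : ∑ z ∈ latticeBox d M, walkKernel ℤ t z =
      (∑ z ∈ Finset.Icc (-(M : ℤ)) M, lineKernel ℤ (t / d) z) ^ d := by
    rw [Finset.prod_const, Finset.card_univ, Fintype.card_fin] at h
    exact h.symm
  rw [h1]
  gcongr
  have hd1 : (1 : ℝ) ≤ d := by exact_mod_cast hd
  have hsM : t / d ≤ (M : ℝ) ^ 2 / 36 := (div_le_self ht hd1).trans htM
  have hs : 0 ≤ t / d := by positivity
  have hM' : (2 : ℝ) ≤ M := by exact_mod_cast hM
  have h2 := one_sub_le_sum_lineKernel hs M (l := 2 / M) (by positivity)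
  have h3 : Real.cosh (2 / M) - 1 ≤ (2 / M) ^ 2 := cosh_sub_one_le (by
    rw [abs_of_nonneg (by positivity), div_le_one (by positivity)]; exact hM')
  have h4 : t / d * (Real.cosh (2 / M) - 1) ≤ (M : ℝ) ^ 2 / 36 * (2 / M) ^ 2 := by
    apply mul_le_mul hsM h3 (by linarith [Real.one_le_cosh (2 / (M : ℝ))]) (by positivity)
  have h5 : (M : ℝ) ^ 2 / 36 * (2 / M) ^ 2 = 1 / 9 := by field_simp; norm_num
  have h6 : -(2 / (M : ℝ)) * M = -2 := by field_simp
  have h7 : Real.exp (-(2 / (M : ℝ)) * M + t / d * (Real.cosh (2 / M) - 1)) ≤ 1 / 4 := by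
    calc _ ≤ Real.exp (-(17 / 9)) := by
          apply Real.exp_le_exp.2; rw [h6]; linarith
      _ ≤ 1 / 4 := by
        rw [Real.exp_neg, inv_le_comm₀ (Real.exp_pos _) (by norm_num)]
        linarith [Real.quadratic_le_exp_of_nonneg (x := 17 / 9) (by norm_num)]
  linarith

end

section

/-- The Green function of the walk on `R ^ d` up to time `T`. -/
def greenUpTo {d : ℕ} (R : Type*) [Ring R] [DecidableEq R] (T : ℝ) (z : Fin d → R) : ℝ :=
  ∫ t in (0 : ℝ)..T, walkKernel R t z

/-- The Green function of the walk on the lattice. -/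
def green {d : ℕ} (z : Lattice d) : ℝ := ∫ t in Set.Ioi (0 : ℝ), walkKernel ℤ t z

section general
variable {d : ℕ} {R : Type*} [Ring R] [DecidableEq R]

lemma intervalIntegrable_walkKernel (hd : 0 < d) (z : Fin d → R) (a b : ℝ) :
    IntervalIntegrable (fun t => walkKernel R t z) volume a b :=
  (continuous_walkKernel hd z).intervalIntegrable a b

lemma stepMean_greenUpTo (hd : 0 < d) (T : ℝ) (z : Fin d → R) :
    stepMean (greenUpTo R T) z =
      greenUpTo R T z + walkKernel R T z - (if z = 0 then 1 else 0) := by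
  have h1 : ∫ t in (0 : ℝ)..T, (stepMean (walkKernel R t) z - walkKernel R t z) =
      walkKernel R T z - walkKernel R 0 z := by
    refine intervalIntegral.integral_eq_sub_of_hasDerivAt
      (fun t _ => hasDerivAt_walkKernel hd t z) ?_
    refine Continuous.intervalIntegrable ?_ _ _
    unfold stepMean
    refine Continuous.sub (Continuous.div_const (continuous_finsetSum _ fun s _ => ?_) _) ?_
    · exact continuous_walkKernel hd _
    · exact continuous_walkKernel hd _
  have h2 : ∫ t in (0 : ℝ)..T, stepMean (walkKernel R t) z = stepMean (greenUpTo R T) z := by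
    simp only [stepMean, greenUpTo]
    rw [intervalIntegral.integral_div, intervalIntegral.integral_finsetSum]
    exact fun s _ => intervalIntegrable_walkKernel hd _ _ _
  rw [intervalIntegral.integral_sub _ (intervalIntegrable_walkKernel hd z 0 T), h2,
    walkKernel_zero] at h1
  · simp only [greenUpTo] at h1 ⊢
    linarith
  · refine Continuous.intervalIntegrable ?_ _ _
    unfold stepMean
    exact Continuous.div_const (continuous_finsetSum _ fun s _ => continuous_walkKernel hd _) _

lemma greenUpTo_le {T : ℝ} (hd : 0 < d) (hT : 0 ≤ T) (z : Fin d → R) : greenUpTo R T z ≤ T := by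
  have := intervalIntegral.integral_mono_on hT (intervalIntegrable_walkKernel hd z 0 T)
    (intervalIntegrable_const (c := (1 : ℝ))) fun _ ht => walkKernel_le_one ht.1 z
  simpa [greenUpTo] using this

end general

variable {d : ℕ}

lemma integrableOn_Ioi_walkKernel (hd : 3 ≤ d) {T : ℝ} (hT : 0 ≤ T) (z : Lattice d) :
    IntegrableOn (fun t => walkKernel ℤ t z) (Set.Ioi T) := by
  have h3 : (3 : ℝ) ≤ d := by exact_mod_cast hd
  have hc := continuous_walkKernel (R := ℤ) (by omega) z
  have h1 : IntegrableOn (fun t => walkKernel ℤ t z) (Set.Ioi 1) := by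
    refine Integrable.mono' (g := fun t => (d : ℝ) ^ ((d : ℝ) / 2) * t ^ (-((d : ℝ) / 2)))
      ((integrableOn_Ioi_rpow_of_lt (by linarith) one_pos).const_mul _)
      hc.aestronglyMeasurable ?_
    filter_upwards [ae_restrict_mem measurableSet_Ioi] with t ht
    have ht0 : 0 < t := one_pos.trans ht
    rw [Real.norm_eq_abs, abs_of_nonneg (walkKernel_nonneg ht0.le z)]
    exact walkKernel_le_rpow (by omega) ht0 z
  have h2 : IntegrableOn (fun t => walkKernel ℤ t z) (Set.Ioc 0 1) :=
    (hc.intervalIntegrable 0 1).1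
  have h4 := h2.union h1
  rw [Set.Ioc_union_Ioi_eq_Ioi zero_le_one] at h4
  exact h4.mono_set (Set.Ioi_subset_Ioi hT)

lemma green_eq_greenUpTo_add (hd : 3 ≤ d) {T : ℝ} (hT : 0 ≤ T) (z : Lattice d) :
    green z = greenUpTo ℤ T z + ∫ t in Set.Ioi T, walkKernel ℤ t z :=
  (intervalIntegral.integral_interval_add_Ioi (integrableOn_Ioi_walkKernel hd le_rfl z)
    (integrableOn_Ioi_walkKernel hd hT z)).symm

lemma integral_Ioi_walkKernel_nonneg {T : ℝ} (hT : 0 ≤ T) (z : Lattice d) :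
    0 ≤ ∫ t in Set.Ioi T, walkKernel ℤ t z :=
  setIntegral_nonneg measurableSet_Ioi fun _ ht =>
    walkKernel_nonneg (hT.trans (le_of_lt ht)) z

lemma integral_Ioi_walkKernel_le (hd : 3 ≤ d) {T : ℝ} (hT : 0 < T) (z : Lattice d) :
    ∫ t in Set.Ioi T, walkKernel ℤ t z ≤
      2 * (d : ℝ) ^ ((d : ℝ) / 2) * T ^ (1 - (d : ℝ) / 2) := by
  have h3 : (3 : ℝ) ≤ d := by exact_mod_cast hd
  have h1 := setIntegral_mono_on (integrableOn_Ioi_walkKernel hd hT.le z)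
    ((integrableOn_Ioi_rpow_of_lt (a := -((d : ℝ) / 2)) (by linarith) hT).const_mul
      ((d : ℝ) ^ ((d : ℝ) / 2))) measurableSet_Ioi
    fun t ht => walkKernel_le_rpow (by omega) (hT.trans ht) z
  refine h1.trans ?_
  rw [integral_const_mul, integral_Ioi_rpow_of_lt (by linarith) hT,
    show -((d : ℝ) / 2) + 1 = 1 - (d : ℝ) / 2 by ring]
  have h5 : -T ^ (1 - (d : ℝ) / 2) / (1 - (d : ℝ) / 2) ≤ 2 * T ^ (1 - (d : ℝ) / 2) := by
    rw [← neg_div_neg_eq, neg_neg, div_le_iff₀ (by linarith)]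
    nlinarith [Real.rpow_pos_of_pos hT (1 - (d : ℝ) / 2)]
  calc _ ≤ (d : ℝ) ^ ((d : ℝ) / 2) * (2 * T ^ (1 - (d : ℝ) / 2)) := by gcongr
    _ = _ := by ring

lemma greenUpTo_le_green (hd : 3 ≤ d) {T : ℝ} (hT : 0 ≤ T) (z : Lattice d) :
    greenUpTo ℤ T z ≤ green z := by
  rw [green_eq_greenUpTo_add hd hT]
  linarith [integral_Ioi_walkKernel_nonneg hT z]

lemma green_nonneg (z : Lattice d) : 0 ≤ green z := integral_Ioi_walkKernel_nonneg le_rfl z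

lemma tendsto_greenUpTo (hd : 3 ≤ d) (z : Lattice d) :
    Filter.Tendsto (fun T => greenUpTo ℤ T z) Filter.atTop (nhds (green z)) :=
  intervalIntegral_tendsto_integral_Ioi 0 (integrableOn_Ioi_walkKernel hd le_rfl z)
    Filter.tendsto_id

lemma tendsto_walkKernel (hd : 3 ≤ d) (z : Lattice d) :
    Filter.Tendsto (fun T => walkKernel ℤ T z) Filter.atTop (nhds 0) := by
  have h3 : (3 : ℝ) ≤ d := by exact_mod_cast hd
  have h1 := (tendsto_rpow_neg_atTop (y := (d : ℝ) / 2) (by positivity)).const_mul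
    ((d : ℝ) ^ ((d : ℝ) / 2))
  rw [mul_zero] at h1
  refine tendsto_of_tendsto_of_tendsto_of_le_of_le' tendsto_const_nhds h1 ?_ ?_
  · filter_upwards [Filter.eventually_ge_atTop 0] with t ht using walkKernel_nonneg ht z
  · filter_upwards [Filter.eventually_gt_atTop 0] with t ht using
      walkKernel_le_rpow (by omega) ht z

lemma stepMean_green (hd : 3 ≤ d) (z : Lattice d) :
    stepMean green z = green z - (if z = 0 then 1 else 0) := by
  have h1 : Filter.Tendsto (fun T => stepMean (greenUpTo ℤ T) z) Filter.atTop
      (nhds (stepMean green z)) := by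
    unfold stepMean
    exact (tendsto_finsetSum _ fun s _ => tendsto_greenUpTo hd _).div_const _
  have h2 := ((tendsto_greenUpTo hd z).add (tendsto_walkKernel hd z)).sub_const
    (if z = 0 then (1 : ℝ) else 0)
  rw [add_zero] at h2
  refine tendsto_nhds_unique h1 (h2.congr fun T => ?_)
  rw [stepMean_greenUpTo (by omega)]

lemma finite_setOf_le_green (hd : 3 ≤ d) {ε : ℝ} (hε : 0 < ε) :
    {z : Lattice d | ε ≤ green z}.Finite := by
  have h3 : (3 : ℝ) ≤ d := by exact_mod_cast hd
  have h1 := (tendsto_rpow_neg_atTop (y := (d : ℝ) / 2 - 1) (by linarith)).const_mul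
    (2 * (d : ℝ) ^ ((d : ℝ) / 2))
  rw [mul_zero] at h1
  obtain ⟨T, hT, hT0⟩ := ((h1.eventually (gt_mem_nhds (half_pos hε))).and
    (Filter.eventually_gt_atTop 0)).exists
  set c : ℝ := T * (2 * Real.exp (T * (Real.cosh 1 - 1))) with hc
  have hc0 : 0 < c := by positivity
  have h2 : Filter.Tendsto (fun M : ℕ => c * Real.exp (-(M : ℝ))) Filter.atTop (nhds (c * 0)) :=
    (Real.tendsto_exp_neg_atTop_nhds_zero.comp tendsto_natCast_atTop_atTop).const_mul c
  rw [mul_zero] at h2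
  obtain ⟨M, hM⟩ := (h2.eventually (gt_mem_nhds (half_pos hε))).exists
  refine (latticeBox d M).finite_toSet.subset fun z hz => ?_
  rw [Finset.mem_coe, mem_latticeBox]
  intro i
  by_contra! hi
  have hi' : (M : ℝ) ≤ |(z i : ℝ)| := by exact_mod_cast hi.le
  have h4 : greenUpTo ℤ T z ≤ c * Real.exp (-(M : ℝ)) := by
    have := intervalIntegral.integral_mono_on hT0.le
      (intervalIntegrable_walkKernel (R := ℤ) (by omega) z 0 T)
      (intervalIntegrable_const
        (c := 2 * Real.exp (-(M : ℝ) + T * (Real.cosh 1 - 1)))) fun t ht => ?_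
    · rw [intervalIntegral.integral_const] at this
      refine this.trans_eq ?_
      rw [hc, Real.exp_add, smul_eq_mul]
      ring
    · refine (walkKernel_le_exp ht.1 z i).trans ?_
      have h6 : t / d ≤ T := (div_le_self ht.1 (by linarith)).trans ht.2
      have h7 : 0 ≤ Real.cosh 1 - 1 := by linarith [Real.one_le_cosh 1]
      gcongr
  have h5 := integral_Ioi_walkKernel_le hd hT0 z
  have h6 := green_eq_greenUpTo_add hd hT0.le z
  rw [neg_sub] at hT
  have : ε ≤ green z := hz
  linarith

lemma sum_green_ge (hd : 3 ≤ d) {M : ℕ} (hM : 2 ≤ M) :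
    (1 / 2 : ℝ) ^ d * ((M : ℝ) ^ 2 / 36) ≤ ∑ z ∈ latticeBox d M, green z := by
  have hT : (0 : ℝ) ≤ (M : ℝ) ^ 2 / 36 := by positivity
  refine le_trans ?_ (Finset.sum_le_sum fun z _ => greenUpTo_le_green hd hT z)
  simp only [greenUpTo]
  rw [← intervalIntegral.integral_finsetSum fun z _ => intervalIntegrable_walkKernel (by omega) z _ _]
  have := intervalIntegral.integral_mono_on hT
    (intervalIntegrable_const (c := (1 / 2 : ℝ) ^ d) (μ := volume)) (f := fun _ => (1 / 2 : ℝ) ^ d)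
    (g := fun t => ∑ z ∈ latticeBox d M, walkKernel ℤ t z) ?_
    fun t ht => half_pow_le_sum_walkKernel (by omega) hM ht.1 ht.2
  · rw [intervalIntegral.integral_const, smul_eq_mul] at this
    linarith
  · exact (continuous_finsetSum _ fun z _ =>
      continuous_walkKernel (by omega) z).intervalIntegrable _ _

lemma exists_exp_neg_le_rpow {a : ℝ} (ha : 0 < a) (b : ℝ) :
    ∃ C : ℝ, 0 < C ∧ ∀ x : ℝ, 1 ≤ x → Real.exp (-(x ^ a / 2)) ≤ C * x ^ (-b) := by
  obtain ⟨m, hm⟩ := exists_nat_ge (b / a)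
  rw [div_le_iff₀ ha] at hm
  refine ⟨2 ^ m * m.factorial, by positivity, fun x hx => ?_⟩
  have hx0 : 0 < x := by linarith
  have hy : 0 < x ^ a := Real.rpow_pos_of_pos hx0 a
  have h1 := Real.pow_div_factorial_le_exp (x ^ a / 2) (by positivity) m
  have h2 : x ^ b ≤ (x ^ a) ^ m := by
    rw [← Real.rpow_natCast, ← Real.rpow_mul hx0.le]
    exact Real.rpow_le_rpow_of_exponent_le hx (by linarith)
  rw [Real.exp_neg, Real.rpow_neg hx0.le, ← div_eq_mul_inv, le_div_iff₀ (by positivity),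
    inv_mul_le_iff₀ (Real.exp_pos _)]
  rw [div_le_iff₀ (by positivity), div_pow, div_le_iff₀ (by positivity)] at h1
  nlinarith

/-- Up to a time a little larger than `N ^ 2`, the Green function of the torus is close to that of
the lattice, within half the side length of the torus. -/
lemma exists_abs_greenUpTo_sub_green_le (hd : 3 ≤ d) {δ : ℝ} (hδ : 0 < δ) (hδ1 : δ < 1) :
    ∃ C : ℝ, 0 < C ∧ ∀ (N : ℕ) [NeZero N] (z : Lattice d), (∀ i, |(z i : ℝ)| ≤ N / 2) →
      |greenUpTo (ZMod N) ((N : ℝ) ^ (2 + δ)) (fun i => (z i : ZMod N)) - green z| ≤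
        C * (N : ℝ) ^ (2 - d + δ * (1 + d / 2)) := by
  have h3 : (3 : ℝ) ≤ d := by exact_mod_cast hd
  have hd0 : 0 < d := by omega
  obtain ⟨C₁, hC₁, hexp⟩ := exists_exp_neg_le_rpow (a := δ / 2) (by positivity) (d : ℝ)
  refine ⟨d * (2 * Real.exp 1 * C₁) + (1 + 2 * √d) ^ d + 2 * (d : ℝ) ^ ((d : ℝ) / 2),
    by positivity, fun N _ z hz => ?_⟩
  have hN : (1 : ℝ) ≤ N := by exact_mod_cast NeZero.one_le
  have hN0 : (0 : ℝ) < N := by linarith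
  set E : ℝ := (N : ℝ) ^ (2 - d + δ * (1 + d / 2)) with hE
  set T : ℝ := (N : ℝ) ^ (2 + δ) with hT
  set T₀ : ℝ := (N : ℝ) ^ (2 - δ) with hT₀
  have hT0 : 0 < T := by positivity
  have hT₀0 : 0 < T₀ := by positivity
  have hTT : T₀ ≤ T := Real.rpow_le_rpow_of_exponent_le hN (by linarith)
  set w : Torus d N := fun i => (z i : ZMod N) with hw
  have hlow : ∀ t, 0 ≤ t → walkKernel ℤ t z ≤ walkKernel (ZMod N) t w :=
    fun t ht => walkKernel_le_zmod ht z
  have hi : ∀ a b, IntervalIntegrable (fun t => walkKernel ℤ t z) volume a b :=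
    intervalIntegrable_walkKernel hd0 z
  have hi' : ∀ a b, IntervalIntegrable (fun t => walkKernel (ZMod N) t w) volume a b :=
    intervalIntegrable_walkKernel hd0 w
  have hdiff : greenUpTo (ZMod N) T w - greenUpTo ℤ T z =
      (∫ t in (0 : ℝ)..T₀, (walkKernel (ZMod N) t w - walkKernel ℤ t z)) +
        ∫ t in T₀..T, (walkKernel (ZMod N) t w - walkKernel ℤ t z) := by
    rw [intervalIntegral.integral_add_adjacent_intervals ((hi' _ _).sub (hi _ _))
      ((hi' _ _).sub (hi _ _)), intervalIntegral.integral_sub (hi' _ _) (hi _ _)]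
    rfl
  have hshort : ∫ t in (0 : ℝ)..T₀, (walkKernel (ZMod N) t w - walkKernel ℤ t z) ≤
      d * (2 * Real.exp 1 * C₁) * E := by
    set l : ℝ := (N : ℝ) ^ (-1 + δ / 2) with hl
    have hl0 : 0 ≤ l := by positivity
    have hl1 : |l| ≤ 1 := by
      rw [abs_of_nonneg hl0]; exact Real.rpow_le_one_of_one_le_of_nonpos hN (by linarith)
    have hlN : -l * (N / 2) = -((N : ℝ) ^ (δ / 2) / 2) := by
      have : (N : ℝ) ^ (δ / 2) = l * N := by
        rw [hl]; nth_rewrite 3 [← Real.rpow_one (N : ℝ)]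
        rw [← Real.rpow_add hN0]; ring_nf
      rw [this]; ring
    have hlT : T₀ * l ^ 2 = 1 := by
      rw [hl, ← Real.rpow_natCast, ← Real.rpow_mul hN0.le, hT₀, ← Real.rpow_add hN0]
      convert Real.rpow_zero (N : ℝ) using 2
      push_cast; ring
    have hb : ∀ t ∈ Set.Icc 0 T₀, walkKernel (ZMod N) t w - walkKernel ℤ t z ≤
        d * (2 * (Real.exp 1 * (C₁ * (N : ℝ) ^ (-(d : ℝ))))) := by
      intro t ht
      have h4 := walkKernel_zmod_le_add ht.1 hz hl0
      have h5 : t / d * (Real.cosh l - 1) ≤ 1 := by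
        have h6 : t / d ≤ T₀ := (div_le_self ht.1 (by linarith)).trans ht.2
        have h7 := cosh_sub_one_le hl1
        calc t / d * (Real.cosh l - 1) ≤ T₀ * l ^ 2 :=
              mul_le_mul h6 h7 (by linarith [Real.one_le_cosh l]) hT₀0.le
          _ = 1 := hlT
      have h8 : Real.exp (-l * (N / 2) + t / d * (Real.cosh l - 1)) ≤
          Real.exp 1 * (C₁ * (N : ℝ) ^ (-(d : ℝ))) := by
        rw [hlN, add_comm, Real.exp_add]
        exact mul_le_mul (Real.exp_le_exp.2 h5) (hexp N hN) (Real.exp_pos _).le (Real.exp_pos _).le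
      have h9 : (d : ℝ) * (2 * Real.exp (-l * (N / 2) + t / d * (Real.cosh l - 1))) ≤
          d * (2 * (Real.exp 1 * (C₁ * (N : ℝ) ^ (-(d : ℝ))))) := by gcongr
      linarith
    have := intervalIntegral.integral_mono_on hT₀0.le ((hi' _ _).sub (hi _ _))
      intervalIntegrable_const hb
    rw [intervalIntegral.integral_const, smul_eq_mul, sub_zero] at this
    refine this.trans ?_
    have h10 : T₀ * (N : ℝ) ^ (-(d : ℝ)) ≤ E := by
      rw [hT₀, ← Real.rpow_add hN0]
      exact Real.rpow_le_rpow_of_exponent_le hN (by nlinarith)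
    calc _ = d * (2 * Real.exp 1 * C₁) * (T₀ * (N : ℝ) ^ (-(d : ℝ))) := by ring
      _ ≤ _ := by gcongr
  have hmid : ∫ t in T₀..T, (walkKernel (ZMod N) t w - walkKernel ℤ t z) ≤
      (1 + 2 * √d) ^ d * E := by
    have hb : ∀ t ∈ Set.Icc T₀ T, walkKernel (ZMod N) t w - walkKernel ℤ t z ≤
        ((1 + 2 * √d) * (N : ℝ) ^ (-1 + δ / 2)) ^ d := by
      intro t ht
      have ht0 : 0 < t := hT₀0.trans_le ht.1
      have h4 := walkKernel_zmod_le hd0 ht0 w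
      have h5 := walkKernel_nonneg ht0.le z
      have h6 : 1 / (N : ℝ) ≤ (N : ℝ) ^ (-1 + δ / 2) := by
        rw [one_div, ← Real.rpow_neg_one]
        exact Real.rpow_le_rpow_of_exponent_le hN (by linarith)
      have h7 : 1 / √t ≤ (N : ℝ) ^ (-1 + δ / 2) := by
        have : √T₀ = (N : ℝ) ^ (1 - δ / 2) := by
          rw [Real.sqrt_eq_rpow, hT₀, ← Real.rpow_mul hN0.le]; ring_nf
        rw [show -1 + δ / 2 = -(1 - δ / 2) by ring, Real.rpow_neg hN0.le, ← this, one_div]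
        have := Real.sqrt_pos.2 hT₀0
        gcongr
        exact ht.1
      have h8 : 2 / √(t / d) = 2 * √d * (1 / √t) := by
        rw [Real.sqrt_div' _ (by positivity)]
        field_simp
      have h9 : 1 / (N : ℝ) + 2 / √(t / d) ≤ (1 + 2 * √d) * (N : ℝ) ^ (-1 + δ / 2) := by
        rw [h8, add_mul, one_mul]
        gcongr
      have : (1 / (N : ℝ) + 2 / √(t / d)) ^ d ≤ ((1 + 2 * √d) * (N : ℝ) ^ (-1 + δ / 2)) ^ d := by
        gcongr
      linarith
    have := intervalIntegral.integral_mono_on hTT ((hi' _ _).sub (hi _ _))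
      intervalIntegrable_const hb
    rw [intervalIntegral.integral_const, smul_eq_mul] at this
    refine this.trans ?_
    have h10 : T * ((N : ℝ) ^ (-1 + δ / 2)) ^ d = E := by
      rw [← Real.rpow_natCast ((N : ℝ) ^ (-1 + δ / 2)), ← Real.rpow_mul hN0.le, hT,
        ← Real.rpow_add hN0, hE]
      ring_nf
    calc _ ≤ T * ((1 + 2 * √d) * (N : ℝ) ^ (-1 + δ / 2)) ^ d := by gcongr; linarith
      _ = (1 + 2 * √d) ^ d * (T * ((N : ℝ) ^ (-1 + δ / 2)) ^ d) := by rw [mul_pow]; ring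
      _ ≤ _ := by rw [h10]
  have htail : ∫ t in Set.Ioi T, walkKernel ℤ t z ≤ 2 * (d : ℝ) ^ ((d : ℝ) / 2) * E := by
    refine (integral_Ioi_walkKernel_le hd hT0 z).trans ?_
    gcongr
    rw [hT, ← Real.rpow_mul hN0.le]
    exact Real.rpow_le_rpow_of_exponent_le hN (by nlinarith)
  have htail0 := integral_Ioi_walkKernel_nonneg hT0.le z
  have hdiff0 : 0 ≤ greenUpTo (ZMod N) T w - greenUpTo ℤ T z := by
    rw [hdiff]
    refine add_nonneg (intervalIntegral.integral_nonneg hT₀0.le fun t ht => ?_)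
      (intervalIntegral.integral_nonneg hTT fun t ht => ?_)
    · linarith [hlow t ht.1]
    · linarith [hlow t (hT₀0.le.trans ht.1)]
  have hg := green_eq_greenUpTo_add hd hT0.le z
  have hE0 : 0 < E := by positivity
  have e1 : 0 ≤ d * (2 * Real.exp 1 * C₁) * E := by positivity
  have e2 : 0 ≤ (1 + 2 * √d) ^ d * E := by positivity
  have e3 : 0 ≤ 2 * (d : ℝ) ^ ((d : ℝ) / 2) * E := by positivity
  rw [abs_le, add_mul, add_mul]
  constructor <;> linarith

end

section

variable {d : ℕ}

open Classical in
/-- The probability that the discrete-time walk started at `x` avoids `V` up to time `k`. -/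
def avoidProb {R : Type*} [Ring R] (V : Set (Fin d → R)) : ℕ → (Fin d → R) → ℝ
  | 0, x => if x ∈ V then 0 else 1
  | k + 1, x => if x ∈ V then 0 else stepMean (avoidProb V k) x

/-- The probability that the discrete-time walk started at `x` avoids `V` forever. -/
def escapeProb {R : Type*} [Ring R] (V : Set (Fin d → R)) (x : Fin d → R) : ℝ :=
  ⨅ k, avoidProb V k x

section general
variable {R : Type*} [Ring R] {V : Set (Fin d → R)}

lemma avoidProb_of_mem {x : Fin d → R} (hx : x ∈ V) (k : ℕ) : avoidProb V k x = 0 := by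
  cases k <;> simp [avoidProb, hx]

lemma avoidProb_zero_of_notMem {x : Fin d → R} (hx : x ∉ V) : avoidProb V 0 x = 1 := by
  simp [avoidProb, hx]

lemma avoidProb_succ_of_notMem {x : Fin d → R} (hx : x ∉ V) (k : ℕ) :
    avoidProb V (k + 1) x = stepMean (avoidProb V k) x := by
  simp [avoidProb, hx]

lemma avoidProb_nonneg (k : ℕ) (x : Fin d → R) : 0 ≤ avoidProb V k x := by
  induction k generalizing x with
  | zero => simp only [avoidProb]; split_ifs <;> norm_num
  | succ k ih =>
    simp only [avoidProb]; split_ifs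
    exacts [le_rfl, stepMean_nonneg ih x]

lemma avoidProb_le_one (hd : 0 < d) (k : ℕ) (x : Fin d → R) : avoidProb V k x ≤ 1 := by
  induction k generalizing x with
  | zero => simp only [avoidProb]; split_ifs <;> norm_num
  | succ k ih =>
    simp only [avoidProb]; split_ifs
    exacts [zero_le_one, stepMean_le hd ih x]

lemma avoidProb_succ_le (hd : 0 < d) (k : ℕ) (x : Fin d → R) :
    avoidProb V (k + 1) x ≤ avoidProb V k x := by
  induction k generalizing x with
  | zero =>
    by_cases hx : x ∈ V
    · simp [avoidProb_of_mem hx]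
    · rw [avoidProb_zero_of_notMem hx]; exact avoidProb_le_one hd _ _
  | succ k ih =>
    by_cases hx : x ∈ V
    · simp [avoidProb_of_mem hx]
    · rw [avoidProb_succ_of_notMem hx, avoidProb_succ_of_notMem hx]
      exact stepMean_mono ih x

lemma one_sub_le_avoidProb (hd : 0 < d) {u : (Fin d → R) → ℝ} (hu0 : ∀ x, 0 ≤ u x)
    (huV : ∀ x ∈ V, 1 ≤ u x) (hu : ∀ x, stepMean u x ≤ u x) (k : ℕ) (x : Fin d → R) :
    1 - u x ≤ avoidProb V k x := by
  induction k generalizing x with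
  | zero =>
    by_cases hx : x ∈ V
    · rw [avoidProb_of_mem hx]; linarith [huV x hx]
    · rw [avoidProb_zero_of_notMem hx]; linarith [hu0 x]
  | succ k ih =>
    by_cases hx : x ∈ V
    · rw [avoidProb_of_mem hx]; linarith [huV x hx]
    · rw [avoidProb_succ_of_notMem hx]
      have := stepMean_mono ih x
      rw [stepMean_sub (fun _ => 1), stepMean_const hd] at this
      linarith [hu x]

lemma bddBelow_avoidProb (x : Fin d → R) : BddBelow (Set.range fun k => avoidProb V k x) :=
  ⟨0, by rintro _ ⟨k, rfl⟩; exact avoidProb_nonneg k x⟩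

lemma tendsto_avoidProb (hd : 0 < d) (x : Fin d → R) :
    Filter.Tendsto (fun k => avoidProb V k x) Filter.atTop (nhds (escapeProb V x)) :=
  tendsto_atTop_ciInf (antitone_nat_of_succ_le fun k => avoidProb_succ_le hd k x)
    (bddBelow_avoidProb x)

lemma tendsto_stepMean_avoidProb (hd : 0 < d) (x : Fin d → R) :
    Filter.Tendsto (fun k => stepMean (avoidProb V k) x) Filter.atTop
      (nhds (stepMean (escapeProb V) x)) := by
  unfold stepMean
  exact (tendsto_finsetSum _ fun s _ => tendsto_avoidProb hd _).div_const _

lemma escapeProb_nonneg (x : Fin d → R) : 0 ≤ escapeProb V x :=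
  le_ciInf fun k => avoidProb_nonneg k x

lemma escapeProb_le_one (hd : 0 < d) (x : Fin d → R) : escapeProb V x ≤ 1 :=
  (ciInf_le (bddBelow_avoidProb x) 0).trans (avoidProb_le_one hd 0 x)

lemma escapeProb_of_mem {x : Fin d → R} (hx : x ∈ V) : escapeProb V x = 0 := by
  simp [escapeProb, avoidProb_of_mem hx]

lemma escapeProb_of_notMem (hd : 0 < d) {x : Fin d → R} (hx : x ∉ V) :
    escapeProb V x = stepMean (escapeProb V) x := by
  have h1 := (tendsto_avoidProb (V := V) hd x).comp (Filter.tendsto_add_atTop_nat 1)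
  refine tendsto_nhds_unique h1 ((tendsto_stepMean_avoidProb hd x).congr fun k => ?_)
  exact (avoidProb_succ_of_notMem hx k).symm

end general

/-- A harmonic function on the lattice that vanishes at infinity is non-positive. -/
lemma nonpos_of_stepMean_eq (hd : 0 < d) {D : Lattice d → ℝ} (hD : ∀ x, stepMean D x = D x)
    (hfin : ∀ ε > 0, {x | ε ≤ D x}.Finite) (x : Lattice d) : D x ≤ 0 := by
  by_contra! hx
  let i : Fin d := ⟨0, hd⟩
  obtain ⟨y, hy, hmax⟩ := Set.exists_max_image _ D (hfin _ hx) ⟨x, le_refl (D x)⟩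
  have hmax' : ∀ z, D z ≤ D y := fun z => by
    by_cases hz : D x ≤ D z
    · exact hmax z hz
    · exact (not_le.1 hz).le.trans hy
  have hyx : D x ≤ D y := hy
  obtain ⟨z, hz, hzmax⟩ := Set.exists_max_image _ (fun z : Lattice d => z i)
    (hfin _ (hx.trans_le hyx)) ⟨y, le_refl (D y)⟩
  have hzy : D z = D y := le_antisymm (hmax' z) hz
  have hz1 : D (z + unitStep ℤ (i, true)) < D y := by
    by_contra! h
    have := hzmax _ h
    simp [unitStep] at this
  have hlt : ∑ s : Fin d × Bool, D (z + unitStep ℤ s) < ∑ _s : Fin d × Bool, D y :=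
    Finset.sum_lt_sum (fun s _ => hmax' _) ⟨(i, true), Finset.mem_univ _, hz1⟩
  have h2 : stepMean D z < stepMean (fun _ => D y) z := by
    unfold stepMean
    gcongr
  rw [stepMean_const hd, hD, hzy] at h2
  exact lt_irrefl _ h2

lemma one_le_green_zero (hd : 3 ≤ d) : 1 ≤ green (0 : Lattice d) := by
  have h := stepMean_green hd 0
  have h1 := stepMean_nonneg (green_nonneg (d := d)) 0
  rw [if_pos rfl] at h
  linarith

lemma green_neg (z : Lattice d) : green (-z) = green z := by
  simp [green, walkKernel, lineKernel, lazyKernel_neg]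

lemma finite_setOf_le_sum_green (hd : 3 ≤ d) (V : Finset (Lattice d)) {ε : ℝ} (hε : 0 < ε) :
    {x : Lattice d | ε ≤ ∑ y ∈ V, green (x - y)}.Finite := by
  have hc : (0 : ℝ) < V.card + 1 := by positivity
  have h1 : (⋃ y ∈ V, {x : Lattice d | ε / (V.card + 1) ≤ green (x - y)}).Finite := by
    refine V.finite_toSet.biUnion fun y _ => ?_
    refine ((finite_setOf_le_green hd (ε := ε / (V.card + 1)) (by positivity)).preimage
      (f := fun x => x - y) ?_)
    exact (sub_left_injective).injOn
  refine h1.subset fun x hx => ?_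
  by_contra h
  simp only [Set.mem_iUnion, Set.mem_ofPred_eq, not_exists, not_le] at h
  have h2 : ∑ y ∈ V, green (x - y) ≤ ∑ _y ∈ V, ε / (V.card + 1) :=
    Finset.sum_le_sum fun y hy => (h y hy).le
  rw [Finset.sum_const, nsmul_eq_mul, mul_div_assoc', ] at h2
  have h3 : (V.card : ℝ) * ε / (V.card + 1) < ε := by
    rw [div_lt_iff₀ hc]; linarith
  have : ε ≤ ∑ y ∈ V, green (x - y) := hx
  linarith

/-- The last-exit decomposition of the hitting probability of a finite set. -/
lemma one_sub_escapeProb_eq (hd : 3 ≤ d) (V : Finset (Lattice d)) (x : Lattice d) :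
    1 - escapeProb (V : Set (Lattice d)) x =
      ∑ y ∈ V, green (x - y) * stepMean (escapeProb (V : Set (Lattice d))) y := by
  have hd0 : 0 < d := by omega
  set a := escapeProb (V : Set (Lattice d)) with ha
  have he0 : ∀ y, 0 ≤ stepMean a y := stepMean_nonneg escapeProb_nonneg
  have he1 : ∀ y, stepMean a y ≤ 1 := stepMean_le hd0 (escapeProb_le_one hd0)
  set S : Lattice d → ℝ := fun x => ∑ y ∈ V, green (x - y) with hS
  have hle : ∀ x, 1 - a x ≤ S x := by
    intro x
    have h1 : ∀ k, 1 - S x ≤ avoidProb (V : Set (Lattice d)) k x := by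
      refine fun k => one_sub_le_avoidProb hd0
        (fun x => Finset.sum_nonneg fun y _ => green_nonneg _) (fun x hx => ?_) (fun x => ?_) k x
      · refine le_trans ?_ (Finset.single_le_sum (f := fun y => green (x - y))
          (fun y _ => green_nonneg _) (Finset.mem_coe.1 hx))
        rw [sub_self]; exact one_le_green_zero hd
      · rw [stepMean_finset_sum]
        refine Finset.sum_le_sum fun y _ => ?_
        rw [stepMean_comp_sub, stepMean_green hd]
        split_ifs <;> linarith
    have := le_ciInf h1
    rw [ha, escapeProb]; linarith
  set F : Lattice d → ℝ := fun x => ∑ y ∈ V, green (x - y) * stepMean a y with hF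
  have hF0 : ∀ x, 0 ≤ F x := fun x =>
    Finset.sum_nonneg fun y _ => mul_nonneg (green_nonneg _) (he0 y)
  have hFS : ∀ x, F x ≤ S x := fun x => Finset.sum_le_sum fun y _ =>
    mul_le_of_le_one_right (green_nonneg _) (he1 y)
  have hFm : ∀ x, stepMean F x = F x - if x ∈ V then stepMean a x else 0 := by
    intro x
    rw [hF, stepMean_finset_sum]
    have h1 : ∀ y ∈ V, stepMean (fun x => green (x - y) * stepMean a y) x =
        green (x - y) * stepMean a y - if x = y then stepMean a y else 0 := by
      intro y _
      simp only [mul_comm _ (stepMean a y)]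
      rw [stepMean_const_mul, stepMean_comp_sub, stepMean_green hd]
      simp only [sub_eq_zero]
      split_ifs <;> ring
    rw [Finset.sum_congr rfl h1, Finset.sum_sub_distrib, Finset.sum_ite_eq]
  have ham : ∀ x, stepMean (fun x => 1 - a x) x = 1 - a x - if x ∈ V then stepMean a x else 0 := by
    intro x
    rw [stepMean_sub (fun _ => 1), stepMean_const hd0]
    split_ifs with hx
    · rw [show a x = 0 from escapeProb_of_mem (Finset.mem_coe.2 hx)]; ring
    · rw [show a x = _ from escapeProb_of_notMem hd0 (fun h => hx (Finset.mem_coe.1 h))]; ring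
  have hfin : ∀ ε > 0, {x | ε ≤ S x}.Finite := fun ε hε => finite_setOf_le_sum_green hd V hε
  have ha1 : ∀ x, a x ≤ 1 := escapeProb_le_one hd0
  have h1 := nonpos_of_stepMean_eq hd0 (D := fun x => (1 - a x) - F x) (fun x => by
    rw [stepMean_sub, hFm, ham]; ring) (fun ε hε => (hfin ε hε).subset fun x hx => by
      have h : ε ≤ (1 - a x) - F x := hx
      exact h.trans (by linarith [hle x, hF0 x])) x
  have h2 := nonpos_of_stepMean_eq hd0 (D := fun x => F x - (1 - a x)) (fun x => by
    rw [stepMean_sub, hFm, ham]; ring) (fun ε hε => (hfin ε hε).subset fun x hx => by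
      have h : ε ≤ F x - (1 - a x) := hx
      exact h.trans (by linarith [hFS x, ha1 x])) x
  linarith

lemma sum_green_mul_of_mem (hd : 3 ≤ d) (V : Finset (Lattice d)) {x : Lattice d} (hx : x ∈ V) :
    ∑ y ∈ V, green (x - y) * stepMean (escapeProb (V : Set (Lattice d))) y = 1 := by
  rw [← one_sub_escapeProb_eq hd, escapeProb_of_mem (Finset.mem_coe.2 hx), sub_zero]

lemma sum_stepMean_escapeProb_pos (hd : 3 ≤ d) {V : Finset (Lattice d)} (hV : V.Nonempty) :
    0 < ∑ y ∈ V, stepMean (escapeProb (V : Set (Lattice d))) y := by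
  obtain ⟨x, hx⟩ := hV
  have he0 : ∀ y, 0 ≤ stepMean (escapeProb (V : Set (Lattice d))) y :=
    stepMean_nonneg escapeProb_nonneg
  refine lt_of_le_of_ne (Finset.sum_nonneg fun y _ => he0 y) fun h => ?_
  have h1 := (Finset.sum_eq_zero_iff_of_nonneg fun y _ => he0 y).1 h.symm
  have h2 := sum_green_mul_of_mem hd V hx
  rw [Finset.sum_eq_zero fun y hy => by rw [h1 y hy, mul_zero]] at h2
  exact zero_ne_one h2

lemma sum_stepMean_escapeProb_le (hd : 3 ≤ d) {V : Finset (Lattice d)} {M : ℕ} (hM : 2 ≤ M)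
    (hV : V ⊆ latticeBox d M) :
    (∑ y ∈ V, stepMean (escapeProb (V : Set (Lattice d))) y) *
      ((1 / 2 : ℝ) ^ d * ((M : ℝ) ^ 2 / 36)) ≤ (4 * M + 1) ^ d := by
  set e := stepMean (escapeProb (V : Set (Lattice d))) with he
  have he0 : ∀ y, 0 ≤ e y := stepMean_nonneg escapeProb_nonneg
  have h1 : ∑ x ∈ latticeBox d (2 * M), ∑ y ∈ V, green (x - y) * e y ≤ (4 * M + 1) ^ d := by
    calc _ ≤ ∑ _x ∈ latticeBox d (2 * M), (1 : ℝ) := Finset.sum_le_sum fun x _ => by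
          rw [← one_sub_escapeProb_eq hd]
          linarith [escapeProb_nonneg (V := (V : Set (Lattice d))) x]
      _ = _ := by
        rw [Finset.sum_const, card_latticeBox, nsmul_eq_mul, mul_one]
        push_cast; ring
  refine le_trans ?_ h1
  rw [Finset.sum_comm, Finset.sum_mul]
  refine Finset.sum_le_sum fun y hy => ?_
  rw [← Finset.sum_mul, mul_comm]
  refine mul_le_mul_of_nonneg_right ((sum_green_ge hd hM).trans ?_) (he0 y)
  have h2 : ∑ x ∈ (latticeBox d M).image (fun z => z + y), green (x - y) =
      ∑ z ∈ latticeBox d M, green z := by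
    rw [Finset.sum_image (add_left_injective y).injOn]
    simp
  rw [← h2]
  refine Finset.sum_le_sum_of_subset_of_nonneg (fun x hx => ?_) fun _ _ _ => green_nonneg _
  obtain ⟨z, hz, rfl⟩ := Finset.mem_image.1 hx
  have hy' := mem_latticeBox.1 (hV hy)
  rw [mem_latticeBox] at hz ⊢
  intro i
  have h3 := abs_add_le (z i) (y i)
  have h4 := hz i
  have h5 := hy' i
  rw [Pi.add_apply]; push_cast; linarith

end

section

variable {d N : ℕ}

/-- The mean number of steps after which the discrete-time walk on the torus enters `V`. -/
def meanEntrance (V : Set (Torus d N)) (x : Torus d N) : ℝ := ∑' k, avoidProb V k x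

lemma stepMean_comp_const_sub {R : Type*} [Ring R] (f : (Fin d → R) → ℝ) (x y : Fin d → R) :
    stepMean (fun y => f (x - y)) y = stepMean f (x - y) := by
  simp only [stepMean_eq_sum]
  congr 1
  refine Finset.sum_congr rfl fun i _ => ?_
  rw [Pi.single_neg, sub_add_eq_sub_sub, sub_add_eq_sub_sub, sub_neg_eq_add, ← sub_eq_add_neg,
    add_comm]

lemma meanEntrance_of_mem {V : Set (Torus d N)} {x : Torus d N} (hx : x ∈ V) :
    meanEntrance V x = 0 := by
  simp [meanEntrance, avoidProb_of_mem hx]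

lemma meanEntrance_nonneg {V : Set (Torus d N)} (x : Torus d N) : 0 ≤ meanEntrance V x :=
  tsum_nonneg fun k => avoidProb_nonneg k x

lemma lift_injective : Function.Injective (lift : Torus d N → Lattice d) := fun _ _ h =>
  funext fun i => ZMod.injective_valMinAbs (congrFun h i)

/-- The capacity of a subset of the torus, lifted to the lattice. -/
def liftCapacity (V : Finset (Torus d N)) : ℝ :=
  ∑ x ∈ V, stepMean (escapeProb (lift '' (V : Set (Torus d N)))) (lift x)

lemma liftCapacity_eq (V : Finset (Torus d N)) [DecidableEq (Lattice d)] :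
    liftCapacity V = ∑ x ∈ V.image lift,
      stepMean (escapeProb ((V.image lift : Finset (Lattice d)) : Set (Lattice d))) x := by
  rw [Finset.sum_image lift_injective.injOn, Finset.coe_image]
  rfl

section
variable [NeZero N]

lemma exists_supersolution (hd : 0 < d) (o : Torus d N) :
    ∃ w : Torus d N → ℝ, (∀ x, 0 ≤ w x) ∧ ∀ x, x ≠ o → 1 + stepMean w x ≤ w x := by
  have hN : (0 : ℝ) < N := by exact_mod_cast NeZero.pos N
  have hd' : (0 : ℝ) < d := by positivity
  set T : ℝ := d * (2 ^ (d + 2) * N) ^ 2 with hT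
  have hT0 : 0 < T := by positivity
  have hs : 2 * N / √(T / d) = 1 / 2 ^ (d + 1) := by
    rw [hT, mul_div_cancel_left₀ _ hd'.ne', Real.sqrt_sq (by positivity)]
    field_simp
    ring
  have hq : ∀ z : Torus d N, 1 ≤ 2 * (N : ℝ) ^ d * walkKernel (ZMod N) T z := by
    intro z
    have h := abs_walkKernel_zmod_sub_le hd hT0 (by
      rw [hs, div_le_one (by positivity)]; exact one_le_pow₀ one_le_two) z
    rw [hs, pow_succ, show (2 : ℝ) ^ d * (1 / (2 ^ d * 2)) = 1 / 2 by field_simp] at h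
    linarith [(abs_le.1 h).1]
  refine ⟨fun x => 2 * (N : ℝ) ^ d * (T - greenUpTo (ZMod N) T (x - o)), fun x => ?_,
    fun x hx => ?_⟩
  · exact mul_nonneg (by positivity) (sub_nonneg.2 (greenUpTo_le hd hT0.le _))
  · rw [stepMean_const_mul, stepMean_sub (fun _ => T), stepMean_const hd, stepMean_comp_sub,
      stepMean_greenUpTo hd, if_neg (sub_ne_zero.2 hx)]
    linarith [hq (x - o)]

lemma summable_avoidProb (hd : 0 < d) {V : Set (Torus d N)} (hV : V.Nonempty) (x : Torus d N) :
    Summable fun k => avoidProb V k x := by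
  obtain ⟨o, ho⟩ := hV
  obtain ⟨w, hw0, hw⟩ := exists_supersolution hd o
  refine summable_of_sum_range_le (c := w x) (fun k => avoidProb_nonneg k x) fun n => ?_
  induction n generalizing x with
  | zero => simpa using hw0 x
  | succ n ih =>
    by_cases hx : x ∈ V
    · simpa [avoidProb_of_mem hx] using hw0 x
    · rw [Finset.sum_range_succ', avoidProb_zero_of_notMem hx]
      simp only [avoidProb_succ_of_notMem hx]
      have h1 := stepMean_mono ih x
      rw [stepMean_finset_sum] at h1
      linarith [hw x fun h => hx (h ▸ ho)]

lemma meanEntrance_of_notMem (hd : 0 < d) {V : Set (Torus d N)} (hV : V.Nonempty)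
    {x : Torus d N} (hx : x ∉ V) : meanEntrance V x = 1 + stepMean (meanEntrance V) x := by
  have hs := summable_avoidProb hd hV
  have h1 : stepMean (meanEntrance V) x = ∑' k, stepMean (avoidProb V k) x := by
    simp only [stepMean, meanEntrance]
    rw [tsum_div_const, Summable.tsum_finsetSum fun s _ => hs _]
  rw [meanEntrance, (hs x).tsum_eq_zero_add, avoidProb_zero_of_notMem hx, h1]
  simp only [avoidProb_succ_of_notMem hx]

lemma sum_greenUpTo (hd : 0 < d) (T : ℝ) (x : Torus d N) :
    ∑ y, greenUpTo (ZMod N) T (x - y) = T := by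
  have h1 := Equiv.sum_comp (Equiv.subLeft x) (greenUpTo (ZMod N) T)
  simp only [Equiv.subLeft_apply] at h1
  rw [h1]
  simp only [greenUpTo]
  rw [← intervalIntegral.integral_finsetSum fun z _ => intervalIntegrable_walkKernel hd z _ _]
  simp [sum_walkKernel]

/-- Dynkin's formula for the walk on the torus, in terms of the Green function up to time `T`. -/
lemma sum_greenUpTo_mul (hd : 0 < d) (T : ℝ) (h : Torus d N → ℝ) (x : Torus d N) :
    ∑ y, walkKernel (ZMod N) T (x - y) * h y - h x =
      ∑ y, greenUpTo (ZMod N) T (x - y) * (1 + stepMean h y - h y) - T := by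
  have h1 := sum_mul_stepMean (fun y => greenUpTo (ZMod N) T (x - y)) h
  have h2 : ∀ y, stepMean (fun y => greenUpTo (ZMod N) T (x - y)) y * h y =
      greenUpTo (ZMod N) T (x - y) * h y + walkKernel (ZMod N) T (x - y) * h y -
        (if x = y then h y else 0) := by
    intro y
    rw [stepMean_comp_const_sub, stepMean_greenUpTo hd]
    simp only [sub_eq_zero]
    split_ifs <;> ring
  simp only [h2, Finset.sum_sub_distrib, Finset.sum_add_distrib] at h1
  rw [Finset.sum_ite_eq, if_pos (Finset.mem_univ _)] at h1
  simp only [mul_sub, mul_add, mul_one, Finset.sum_sub_distrib, Finset.sum_add_distrib]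
  rw [sum_greenUpTo hd]
  linarith

lemma sum_one_add_stepMean_sub (hd : 0 < d) (h : Torus d N → ℝ) :
    ∑ y, (1 + stepMean h y - h y) = (N : ℝ) ^ d := by
  have h1 := sum_mul_stepMean h fun _ => 1
  simp only [stepMean_const hd, mul_one] at h1
  rw [Finset.sum_sub_distrib, Finset.sum_add_distrib, h1]
  simp [ZMod.card]

lemma abs_liftCapacity_mul_sub_le (hd : 3 ≤ d) {V : Finset (Torus d N)} (hV : V.Nonempty)
    {T η A : ℝ} (hT : 0 ≤ T)
    (hη : ∀ z : Torus d N, |(N : ℝ) ^ d * walkKernel (ZMod N) T z - 1| ≤ η)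
    (hA : ∀ x ∈ V, ∀ y ∈ V,
      |greenUpTo (ZMod N) T (x - y) - green (lift x - lift y)| ≤ A) :
    |liftCapacity V * (∑ x, meanEntrance (V : Set (Torus d N)) x) / (N : ℝ) ^ d - (N : ℝ) ^ d| ≤
      η * (liftCapacity V * (∑ x, meanEntrance (V : Set (Torus d N)) x) / (N : ℝ) ^ d) +
        (N : ℝ) ^ d * (A * liftCapacity V) + T * liftCapacity V := by
  classical
  have hd0 : 0 < d := by omega
  have hN : (0 : ℝ) < N := by exact_mod_cast NeZero.pos N
  have hn : (0 : ℝ) < (N : ℝ) ^ d := by positivity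
  set h := meanEntrance (V : Set (Torus d N)) with hh
  set e : Torus d N → ℝ :=
    fun x => stepMean (escapeProb (lift '' (V : Set (Torus d N)))) (lift x) with he
  set K : ℝ := liftCapacity V with hK
  have hKe : K = ∑ x ∈ V, e x := rfl
  have he0 : ∀ x, 0 ≤ e x := fun x => stepMean_nonneg escapeProb_nonneg _
  have hK0 : 0 ≤ K := Finset.sum_nonneg fun x _ => he0 x
  set ν : Torus d N → ℝ := fun y => 1 + stepMean h y - h y with hν
  have hν0 : ∀ y, 0 ≤ ν y := by
    intro y
    by_cases hy : y ∈ V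
    · have := stepMean_nonneg (f := h) meanEntrance_nonneg y
      have h2 : h y = 0 := meanEntrance_of_mem (Finset.mem_coe.2 hy)
      simp only [hν]; linarith
    · have h2 : h y = _ := meanEntrance_of_notMem hd0 (V := (V : Set (Torus d N)))
        (by simpa using hV) (by simpa using hy)
      simp only [hν]; linarith
  have hνV : ∀ y, y ∉ V → ν y = 0 := by
    intro y hy
    have h2 : h y = _ := meanEntrance_of_notMem hd0 (V := (V : Set (Torus d N)))
        (by simpa using hV) (by simpa using hy)
    simp only [hν]; linarith
  have hνs : ∑ y, ν y = (N : ℝ) ^ d := sum_one_add_stepMean_sub hd0 h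
  have hpot : ∀ y ∈ V, ∑ x ∈ V, green (lift x - lift y) * e x = 1 := by
    intro y hy
    have h1 := sum_green_mul_of_mem hd (V.image lift) (Finset.mem_image_of_mem _ hy)
    rw [Finset.sum_image lift_injective.injOn, Finset.coe_image] at h1
    rw [← h1]
    refine Finset.sum_congr rfl fun x _ => ?_
    rw [← green_neg, neg_sub]
  have hA' : ∀ y ∈ V, |∑ x ∈ V, e x * greenUpTo (ZMod N) T (x - y) - 1| ≤ A * K := by
    intro y hy
    rw [← hpot y hy, ← Finset.sum_sub_distrib, hKe, Finset.mul_sum]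
    refine (Finset.abs_sum_le_sum_abs _ _).trans (Finset.sum_le_sum fun x hx => ?_)
    rw [mul_comm (green _), ← mul_sub, abs_mul, abs_of_nonneg (he0 x), mul_comm]
    exact mul_le_mul_of_nonneg_right (hA x hx y hy) (he0 x)
  have hdyn : ∑ x ∈ V, e x * ∑ y, walkKernel (ZMod N) T (x - y) * h y =
      ∑ y, ν y * ∑ x ∈ V, e x * greenUpTo (ZMod N) T (x - y) - T * K := by
    have h1 : ∀ x ∈ V, e x * ∑ y, walkKernel (ZMod N) T (x - y) * h y =
        (∑ y, ν y * (e x * greenUpTo (ZMod N) T (x - y))) - T * e x := by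
      intro x hx
      have h2 := sum_greenUpTo_mul hd0 T h x
      have h3 : h x = 0 := meanEntrance_of_mem (Finset.mem_coe.2 hx)
      rw [h3, sub_zero] at h2
      rw [h2, mul_sub, Finset.mul_sum, mul_comm (e x) T]
      congr 1
      refine Finset.sum_congr rfl fun y _ => ?_
      simp only [hν]; ring
    rw [Finset.sum_congr rfl h1, Finset.sum_sub_distrib, Finset.sum_comm, ← Finset.mul_sum, hKe]
    simp only [Finset.mul_sum]
  have hright : |∑ y, ν y * ∑ x ∈ V, e x * greenUpTo (ZMod N) T (x - y) - (N : ℝ) ^ d| ≤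
      (N : ℝ) ^ d * (A * K) := by
    rw [← hνs, ← Finset.sum_sub_distrib, Finset.sum_mul]
    refine (Finset.abs_sum_le_sum_abs _ _).trans (Finset.sum_le_sum fun y _ => ?_)
    by_cases hy : y ∈ V
    · rw [← mul_sub_one, abs_mul, abs_of_nonneg (hν0 y)]
      exact mul_le_mul_of_nonneg_left (hA' y hy) (hν0 y)
    · simp [hνV y hy]
  have hleft : |∑ x ∈ V, e x * ∑ y, walkKernel (ZMod N) T (x - y) * h y -
      K * (∑ x, h x) / (N : ℝ) ^ d| ≤ η * (K * (∑ x, h x) / (N : ℝ) ^ d) := by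
    have h1 : K * (∑ x, h x) / (N : ℝ) ^ d = ∑ x ∈ V, e x * ∑ y, h y / (N : ℝ) ^ d := by
      rw [hKe, ← Finset.sum_mul, ← Finset.sum_div, mul_div_assoc]
    rw [h1, ← Finset.sum_sub_distrib, Finset.mul_sum]
    refine (Finset.abs_sum_le_sum_abs _ _).trans (Finset.sum_le_sum fun x _ => ?_)
    rw [← mul_sub, abs_mul, abs_of_nonneg (he0 x), mul_left_comm]
    refine mul_le_mul_of_nonneg_left ?_ (he0 x)
    rw [← Finset.sum_sub_distrib, Finset.mul_sum]
    refine (Finset.abs_sum_le_sum_abs _ _).trans (Finset.sum_le_sum fun y _ => ?_)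
    have h2 : walkKernel (ZMod N) T (x - y) * h y - h y / (N : ℝ) ^ d =
        ((N : ℝ) ^ d * walkKernel (ZMod N) T (x - y) - 1) * (h y / (N : ℝ) ^ d) := by
      field_simp
    have h3 : 0 ≤ h y / (N : ℝ) ^ d := div_nonneg (meanEntrance_nonneg y) hn.le
    rw [h2, abs_mul, abs_of_nonneg h3]
    exact mul_le_mul_of_nonneg_right (hη _) h3
  have hTK : 0 ≤ T * K := mul_nonneg hT hK0
  rw [abs_le] at hleft hright ⊢
  constructor <;> linarith [hleft.1, hleft.2, hright.1, hright.2]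

end

end

section

variable {d : ℕ}

/-- The sequence with first term `a`, followed by the terms of `σ`. -/
def consSeq {A : Type*} (p : A × (ℕ → A)) : ℕ → A
  | 0 => p.1
  | n + 1 => p.2 n

lemma measurable_consSeq {A : Type*} [MeasurableSpace A] : Measurable (consSeq (A := A)) := by
  refine measurable_pi_lambda _ fun n => ?_
  cases n with
  | zero => exact measurable_fst
  | succ n => exact (measurable_pi_apply n).comp measurable_snd

lemma map_consSeq {A : Type*} [MeasurableSpace A] (ν : Measure A) [IsProbabilityMeasure ν] :
    (ν.prod (Measure.infinitePi fun _ : ℕ => ν)).map consSeq =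
      Measure.infinitePi fun _ : ℕ => ν := by
  classical
  refine Measure.eq_infinitePi _ fun s t ht => ?_
  obtain ⟨n, hn⟩ : ∃ n, s ⊆ Finset.range (n + 1) :=
    ⟨s.sup id, fun i hi => Finset.mem_range_succ_iff.2 (Finset.le_sup (f := id) hi)⟩
  set u : ℕ → Set A := fun i => if i ∈ s then t i else Set.univ with hu
  have hum : ∀ i, MeasurableSet (u i) := fun i => by
    simp only [hu]; split_ifs; exacts [ht i, .univ]
  have h1 : ∏ i ∈ s, ν (t i) = ∏ i ∈ Finset.range (n + 1), ν (u i) := by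
    rw [← Finset.prod_subset hn fun i _ hi => by simp [hu, hi]]
    exact Finset.prod_congr rfl fun i hi => by simp [hu, hi]
  have h2 : consSeq ⁻¹' (s : Set ℕ).pi t =
      u 0 ×ˢ (Finset.range n : Set ℕ).pi fun i => u (i + 1) := by
    ext ⟨a, σ⟩
    simp only [Set.mem_preimage, Set.mem_pi, Set.mem_prod, Finset.mem_coe, Finset.mem_range, hu]
    constructor
    · intro h
      refine ⟨?_, fun i _ => ?_⟩
      · split_ifs with h0
        exacts [h 0 h0, trivial]
      · split_ifs with h0
        exacts [h (i + 1) h0, trivial]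
    · rintro ⟨h0, h⟩ i hi
      cases i with
      | zero => rw [if_pos hi] at h0; exact h0
      | succ i =>
        have := h i (by have := Finset.mem_range.1 (hn hi); omega)
        rw [if_pos hi] at this
        exact this
  rw [Measure.map_apply measurable_consSeq (.pi s.countable_toSet fun i _ => ht i), h2,
    Measure.prod_prod, Measure.infinitePi_pi _ fun i _ => hum _, h1, Finset.prod_range_succ',
    mul_comm]

/-- The law of the labels of the steps. -/
abbrev stepLaw (d : ℕ) : Measure (ℕ → Fin d × Bool) :=
  Measure.infinitePi fun _ : ℕ => uniformOn (Set.univ : Set (Fin d × Bool))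

/-- The law of the holding times. -/
abbrev holdingLaw : Measure (ℕ → ℝ) := Measure.infinitePi fun _ : ℕ => expMeasure 1

lemma isProbabilityMeasure_stepUniform (hd : 0 < d) :
    IsProbabilityMeasure (uniformOn (Set.univ : Set (Fin d × Bool))) :=
  isProbabilityMeasure_uniformOn Set.finite_univ ⟨(⟨0, hd⟩, true), trivial⟩

/-- The first step of the walk is uniform, and independent of the later steps. -/
lemma stepLaw_apply (hd : 0 < d) {B : Set (ℕ → Fin d × Bool)} (hB : MeasurableSet B) :
    stepLaw d B = ∑ a, stepLaw d {σ | consSeq (a, σ) ∈ B} * ((2 * d : ℕ) : ℝ≥0∞)⁻¹ := by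
  have := isProbabilityMeasure_stepUniform hd
  conv_lhs => rw [stepLaw, ← map_consSeq (uniformOn (Set.univ : Set (Fin d × Bool)))]
  rw [Measure.map_apply measurable_consSeq hB, Measure.prod_apply (measurable_consSeq hB),
    lintegral_fintype]
  refine Finset.sum_congr rfl fun a _ => ?_
  rw [uniformOn_univ, Measure.count_singleton, one_div, Fintype.card_prod, Fintype.card_fin,
    Fintype.card_bool, mul_comm d 2]
  rfl

/-- The discrete-time walk with steps labelled by `σ`. -/
def stepWalk {R : Type*} [Ring R] (x : Fin d → R) (σ : ℕ → Fin d × Bool) (n : ℕ) : Fin d → R :=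
  x + ∑ k ∈ Finset.range n, unitStep R (σ k)

section general
variable {R : Type*} [Ring R]

lemma stepWalk_consSeq (x : Fin d → R) (a : Fin d × Bool) (σ : ℕ → Fin d × Bool) (n : ℕ) :
    stepWalk x (consSeq (a, σ)) (n + 1) = stepWalk (x + unitStep R a) σ n := by
  simp only [stepWalk, Finset.sum_range_succ', consSeq]
  abel

lemma measurableSet_stepWalk_mem (x : Fin d → R) (n : ℕ) (W : Set (Fin d → R)) :
    MeasurableSet {σ | stepWalk x σ n ∈ W} := by
  induction n generalizing W with
  | zero => simp [stepWalk]
  | succ n ih =>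
    have h : {σ | stepWalk x σ (n + 1) ∈ W} =
        ⋃ a : Fin d × Bool, (fun σ : ℕ → Fin d × Bool => σ n) ⁻¹' {a} ∩
          {σ | stepWalk x σ n ∈ {y | y + unitStep R a ∈ W}} := by
      ext σ
      simp [stepWalk, Finset.sum_range_succ, add_assoc]
    rw [h]
    exact .iUnion fun a => (measurable_pi_apply n (measurableSet_singleton a)).inter (ih _)

/-- The walk with steps labelled by `σ` avoids `V` up to time `k`. -/
def avoidSet (V : Set (Fin d → R)) (k : ℕ) (x : Fin d → R) : Set (ℕ → Fin d × Bool) :=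
  {σ | ∀ j ≤ k, stepWalk x σ j ∉ V}

lemma measurableSet_avoidSet (V : Set (Fin d → R)) (k : ℕ) (x : Fin d → R) :
    MeasurableSet (avoidSet V k x) := by
  have : avoidSet V k x = ⋂ j ≤ k, {σ | stepWalk x σ j ∈ Vᶜ} := by
    ext σ; simp [avoidSet]
  rw [this]
  exact .iInter fun j => .iInter fun _ => measurableSet_stepWalk_mem x j _

lemma stepWalk_zero (x : Fin d → R) (σ : ℕ → Fin d × Bool) : stepWalk x σ 0 = x := by
  simp [stepWalk]

lemma ofReal_stepMean (f : (Fin d → R) → ℝ) (hf : ∀ y, 0 ≤ f y) (hd : 0 < d) (x : Fin d → R) :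
    ENNReal.ofReal (stepMean f x) =
      ∑ a, ENNReal.ofReal (f (x + unitStep R a)) * ((2 * d : ℕ) : ℝ≥0∞)⁻¹ := by
  rw [stepMean, ENNReal.ofReal_div_of_pos (by positivity), ENNReal.ofReal_sum_of_nonneg
    fun _ _ => hf _, ← Finset.sum_mul, ENNReal.div_eq_inv_mul, mul_comm]
  congr 2
  rw [← ENNReal.ofReal_natCast]
  push_cast
  rfl

lemma stepLaw_avoidSet (hd : 0 < d) (V : Set (Fin d → R)) (k : ℕ) (x : Fin d → R) :
    stepLaw d (avoidSet V k x) = ENNReal.ofReal (avoidProb V k x) := by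
  have := isProbabilityMeasure_stepUniform hd
  by_cases hx : x ∈ V
  · rw [avoidProb_of_mem hx, ENNReal.ofReal_zero]
    convert measure_empty (μ := stepLaw d)
    ext σ
    simp only [avoidSet, Set.mem_ofPred_eq, Set.mem_empty_iff_false, iff_false, not_forall]
    exact ⟨0, by omega, by rw [stepWalk_zero]; simpa using hx⟩
  · induction k generalizing x with
    | zero =>
      rw [avoidProb_zero_of_notMem hx, ENNReal.ofReal_one]
      convert measure_univ (μ := stepLaw d)
      ext σ
      simp [avoidSet, stepWalk_zero, hx]
    | succ k ih =>
      rw [stepLaw_apply hd (measurableSet_avoidSet V _ x), avoidProb_succ_of_notMem hx,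
        ofReal_stepMean _ (avoidProb_nonneg k) hd]
      refine Finset.sum_congr rfl fun a _ => ?_
      have h1 : {σ | consSeq (a, σ) ∈ avoidSet V (k + 1) x} = avoidSet V k (x + unitStep R a) := by
        ext σ
        constructor
        · intro h j hj
          rw [← stepWalk_consSeq]
          exact h (j + 1) (by omega)
        · rintro h (_ | j) hj
          · rw [stepWalk_zero]; exact hx
          · rw [stepWalk_consSeq]
            exact h j (by omega)
      rw [h1]
      by_cases hy : x + unitStep R a ∈ V
      · rw [avoidProb_of_mem hy, ENNReal.ofReal_zero]
        congr 1
        convert measure_empty (μ := stepLaw d)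
        ext σ
        simp only [avoidSet, Set.mem_ofPred_eq, Set.mem_empty_iff_false, iff_false, not_forall]
        exact ⟨0, by omega, by rw [stepWalk_zero]; simpa using hy⟩
      · rw [ih _ hy]

lemma stepLaw_iInter_avoidSet (hd : 0 < d) (V : Set (Fin d → R)) (x : Fin d → R) :
    stepLaw d (⋂ k, avoidSet V k x) = ENNReal.ofReal (escapeProb V x) := by
  have := isProbabilityMeasure_stepUniform hd
  have h1 := tendsto_measure_iInter_atTop (μ := stepLaw d) (s := fun k => avoidSet V k x)
    (fun k => (measurableSet_avoidSet V k x).nullMeasurableSet)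
    (fun k l hkl σ hσ j hj => hσ j (hj.trans hkl)) ⟨0, measure_ne_top _ _⟩
  have h2 := (ENNReal.continuous_ofReal.tendsto _).comp (tendsto_avoidProb (V := V) hd x)
  refine tendsto_nhds_unique h1 (h2.congr fun k => ?_)
  exact (stepLaw_avoidSet hd V k x).symm

/-- The probability that the walk does not return to `V` after its first step. -/
lemma stepLaw_forall_one_le (hd : 0 < d) (V : Set (Fin d → R)) (x : Fin d → R) :
    stepLaw d {σ | ∀ j, 1 ≤ j → stepWalk x σ j ∉ V} =
      ENNReal.ofReal (stepMean (escapeProb V) x) := by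
  have hm : MeasurableSet {σ | ∀ j, 1 ≤ j → stepWalk x σ j ∉ V} := by
    have : {σ | ∀ j, 1 ≤ j → stepWalk x σ j ∉ V} =
        ⋂ j, ⋂ (_ : 1 ≤ j), {σ | stepWalk x σ j ∈ Vᶜ} := by
      ext σ; simp
    rw [this]
    exact .iInter fun j => .iInter fun _ => measurableSet_stepWalk_mem x j _
  rw [stepLaw_apply hd hm, ofReal_stepMean _ escapeProb_nonneg hd]
  refine Finset.sum_congr rfl fun a _ => ?_
  rw [← stepLaw_iInter_avoidSet hd]
  congr 2
  ext σ
  simp only [Set.mem_ofPred_eq, Set.mem_iInter, avoidSet]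
  constructor
  · intro h k j _
    rw [← stepWalk_consSeq]
    exact h (j + 1) (by omega)
  · rintro h (_ | j) hj
    · omega
    · rw [stepWalk_consSeq]
      exact h j j le_rfl

end general

/-! ### Holding times -/

lemma isProbabilityMeasure_expMeasure_one : IsProbabilityMeasure (expMeasure 1) :=
  isProbabilityMeasure_expMeasure one_pos

lemma expMeasure_Iic {x : ℝ} (hx : 0 ≤ x) :
    expMeasure 1 (Set.Iic x) = ENNReal.ofReal (1 - Real.exp (-x)) := by
  have := isProbabilityMeasure_expMeasure_one
  rw [← ofReal_cdf, cdf_expMeasure_eq one_pos, if_pos hx, one_mul]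

lemma expMeasure_Ioi {x : ℝ} (hx : 0 ≤ x) :
    expMeasure 1 (Set.Ioi x) = ENNReal.ofReal (Real.exp (-x)) := by
  have := isProbabilityMeasure_expMeasure_one
  rw [← Set.compl_Iic, prob_compl_eq_one_sub measurableSet_Iic, expMeasure_Iic hx,
    ← ENNReal.ofReal_one, ← ENNReal.ofReal_sub _ (by
      rw [sub_nonneg]; exact Real.exp_le_one_iff.2 (by linarith))]
  ring_nf

lemma ae_expMeasure_pos : ∀ᵐ x ∂expMeasure 1, 0 < x := by
  rw [ae_iff]
  have h : {x : ℝ | ¬ 0 < x} = Set.Iic 0 := by ext x; simp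
  rw [h, expMeasure_Iic le_rfl]
  simp

lemma lintegral_toNNReal_expMeasure : ∫⁻ x, (x.toNNReal : ℝ≥0∞) ∂expMeasure 1 = 1 := by
  have h1 := lintegral_eq_lintegral_meas_lt (f := id) (expMeasure 1)
    (ae_expMeasure_pos.mono fun x hx => hx.le) aemeasurable_id
  have h2 : ∫⁻ t in Set.Ioi (0 : ℝ), expMeasure 1 {a | t < id a} =
      ∫⁻ t in Set.Ioi (0 : ℝ), ENNReal.ofReal (Real.exp (-t)) :=
    setLIntegral_congr_fun measurableSet_Ioi fun t ht => expMeasure_Ioi (le_of_lt ht)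
  rw [h2, ← ofReal_integral_eq_lintegral_ofReal (integrableOn_exp_neg_Ioi 0)
    (Filter.Eventually.of_forall fun t => (Real.exp_pos _).le), integral_exp_neg_Ioi_zero,
    ENNReal.ofReal_one] at h1
  exact h1

lemma ae_holdingLaw_pos : ∀ᵐ τ ∂holdingLaw, ∀ k, 0 < τ k := by
  have := isProbabilityMeasure_expMeasure_one
  rw [ae_all_iff]
  exact fun k => (measurePreserving_eval_infinitePi (fun _ : ℕ => expMeasure 1)
    k).quasiMeasurePreserving.ae ae_expMeasure_pos

lemma ae_holdingLaw_frequently : ∀ᵐ τ ∂holdingLaw, ∀ m : ℕ, ∃ k, m ≤ k ∧ 1 < τ k := by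
  have := isProbabilityMeasure_expMeasure_one
  rw [ae_all_iff]
  intro m
  rw [ae_iff]
  set p : ℝ≥0∞ := expMeasure 1 (Set.Iic 1) with hp
  have hp1 : p < 1 := by
    rw [hp, expMeasure_Iic zero_le_one, ← ENNReal.ofReal_one]
    exact (ENNReal.ofReal_lt_ofReal_iff one_pos).2 (by linarith [Real.exp_pos (-1)])
  have h1 : ∀ n : ℕ, holdingLaw {τ | ¬ ∃ k, m ≤ k ∧ 1 < τ k} ≤ p ^ n := by
    intro n
    calc _ ≤ holdingLaw ((Finset.Ico m (m + n) : Set ℕ).pi fun _ => Set.Iic (1 : ℝ)) := by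
          refine measure_mono fun τ hτ k hk => ?_
          simp only [Set.mem_ofPred_eq, not_exists, not_and, not_lt] at hτ
          exact hτ k (Finset.mem_Ico.1 hk).1
      _ = p ^ n := by
        rw [Measure.infinitePi_pi _ fun _ _ => measurableSet_Iic, Finset.prod_const, Nat.card_Ico,
          Nat.add_sub_cancel_left]
  exact le_antisymm (ge_of_tendsto' (ENNReal.tendsto_pow_atTop_nhds_zero_of_lt_one hp1) h1)
    zero_le

end

section

variable {d : ℕ}

/-- The holding times of `ω` are positive, and exceed `1` infinitely often. -/
def RegularHolding (ω : Sample d) : Prop :=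
  (∀ k, 0 < ω.2 k) ∧ ∀ m : ℕ, ∃ k, m ≤ k ∧ 1 < ω.2 k

lemma isProbabilityMeasure_holdingLaw : IsProbabilityMeasure holdingLaw := by
  have := isProbabilityMeasure_expMeasure_one
  infer_instance

lemma isProbabilityMeasure_stepLaw (hd : 0 < d) : IsProbabilityMeasure (stepLaw d) := by
  have := isProbabilityMeasure_stepUniform hd
  infer_instance

lemma ae_regularHolding (hd : 0 < d) : ∀ᵐ ω ∂sampleLaw d, RegularHolding ω := by
  have := isProbabilityMeasure_holdingLaw
  have := isProbabilityMeasure_stepLaw hd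
  exact (Measure.quasiMeasurePreserving_snd (μ := stepLaw d) (ν := holdingLaw)).ae
    (ae_holdingLaw_pos.and ae_holdingLaw_frequently)

section paths
variable {ω : Sample d}

lemma jumpTime_succ (ω : Sample d) (n : ℕ) :
    jumpTime ω (n + 1) = jumpTime ω n + (ω.2 n).toNNReal := by
  simp [jumpTime, Finset.sum_range_succ]

lemma RegularHolding.strictMono (h : RegularHolding ω) : StrictMono (jumpTime ω) :=
  strictMono_nat_of_lt_succ fun n => by
    rw [jumpTime_succ]
    exact lt_add_of_pos_right _ (Real.toNNReal_pos.2 (h.1 n))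

lemma RegularHolding.exists_natCast_le_jumpTime (h : RegularHolding ω) (j : ℕ) :
    ∃ n, (j : ℝ≥0) ≤ jumpTime ω n := by
  induction j with
  | zero => exact ⟨0, by simp⟩
  | succ j ih =>
    obtain ⟨n, hn⟩ := ih
    obtain ⟨k, hk, hk1⟩ := h.2 n
    refine ⟨k + 1, ?_⟩
    rw [jumpTime_succ]
    push_cast
    exact add_le_add (hn.trans (h.strictMono.monotone hk)) (by
      rw [← Real.toNNReal_one]; exact Real.toNNReal_le_toNNReal hk1.le)

lemma RegularHolding.exists_lt_jumpTime (h : RegularHolding ω) (t : ℝ≥0) :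
    ∃ n, t < jumpTime ω n := by
  obtain ⟨j, hj⟩ := exists_nat_gt t
  obtain ⟨n, hn⟩ := h.exists_natCast_le_jumpTime j
  exact ⟨n, hj.trans_le hn⟩

lemma RegularHolding.poissonCount_eq (h : RegularHolding ω) {n : ℕ} {t : ℝ≥0}
    (h1 : jumpTime ω n ≤ t) (h2 : t < jumpTime ω (n + 1)) : poissonCount ω t = n := by
  have : {m : ℕ | 1 ≤ m ∧ jumpTime ω m ≤ t} = (Finset.Icc 1 n : Finset ℕ) := by
    ext m
    simp only [Set.mem_ofPred_eq, Finset.coe_Icc, Set.mem_Icc, and_congr_right_iff]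
    intro _
    constructor
    · intro h3
      have := h.strictMono.lt_iff_lt.1 (h3.trans_lt h2)
      omega
    · intro h3
      exact (h.strictMono.monotone h3).trans h1
  rw [poissonCount, this, Set.ncard_coe_finset, Nat.card_Icc, Nat.add_sub_cancel]

lemma RegularHolding.jumpTime_poissonCount_le (h : RegularHolding ω) (t : ℝ≥0) :
    jumpTime ω (poissonCount ω t) ≤ t := by
  classical
  have hex := h.exists_lt_jumpTime t
  obtain ⟨n, hn⟩ : ∃ n, Nat.find hex = n + 1 := Nat.exists_eq_succ_of_ne_zero fun h0 => by
    have := Nat.find_spec hex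
    rw [h0] at this
    simp [jumpTime] at this
  have h1 : jumpTime ω n ≤ t := not_lt.1 (Nat.find_min hex (by omega))
  rw [h.poissonCount_eq h1 (hn ▸ Nat.find_spec hex)]
  exact h1

lemma RegularHolding.poissonCount_jumpTime (h : RegularHolding ω) (n : ℕ) :
    poissonCount ω (jumpTime ω n) = n :=
  h.poissonCount_eq le_rfl (h.strictMono n.lt_succ_self)

variable {R : Type*} [Ring R] {V : Set (Fin d → R)} {x : Fin d → R}

lemma walk_eq_stepWalk (x : Fin d → R) (ω : Sample d) (t : ℝ≥0) :
    walk x ω t = stepWalk x ω.1 (poissonCount ω t) := rfl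

open Classical in
/-- The entrance time is the sum of the holding times before the first visit to `V`. -/
lemma RegularHolding.entranceTime_eq (h : RegularHolding ω) (V : Set (Fin d → R))
    (x : Fin d → R) :
    entranceTime V (walk x ω) =
      ∑' k, (avoidSet V k x).indicator 1 ω.1 * ((ω.2 k).toNNReal : ℝ≥0∞) := by
  by_cases hex : ∃ n, stepWalk x ω.1 n ∈ V
  · have hfind := Nat.find_spec hex
    have hmin : ∀ m, stepWalk x ω.1 m ∈ V → Nat.find hex ≤ m := fun m hm => Nat.find_min' hex hm
    set κ := Nat.find hex
    have h1 : ∀ k, ω.1 ∈ avoidSet V k x ↔ k < κ := by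
      intro k
      constructor
      · intro hk
        by_contra! hle
        exact hk κ hle hfind
      · intro hk j hj hjV
        have := hmin j hjV
        omega
    rw [tsum_eq_sum (s := Finset.range κ) fun k hk => by
      rw [Set.indicator_of_notMem fun h2 => hk (Finset.mem_range.2 ((h1 k).1 h2)), zero_mul]]
    have h2 : ∑ k ∈ Finset.range κ, (avoidSet V k x).indicator 1 ω.1 *
        ((ω.2 k).toNNReal : ℝ≥0∞) = (jumpTime ω κ : ℝ≥0∞) := by
      rw [jumpTime, ENNReal.ofNNReal_finsetSum]
      refine Finset.sum_congr rfl fun k hk => ?_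
      rw [Set.indicator_of_mem ((h1 k).2 (Finset.mem_range.1 hk)), Pi.one_apply, one_mul]
    rw [h2]
    refine le_antisymm (iInf₂_le _ ?_) (le_iInf₂ fun t ht => ?_)
    · rw [walk_eq_stepWalk, h.poissonCount_jumpTime]
      exact hfind
    · rw [walk_eq_stepWalk] at ht
      exact_mod_cast (h.strictMono.monotone (hmin _ ht)).trans (h.jumpTime_poissonCount_le t)
  · push Not at hex
    have h1 : entranceTime V (walk x ω) = ∞ := by
      simp only [entranceTime, iInf_eq_top]
      exact fun t ht => absurd ht (hex _)
    rw [h1]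
    symm
    refine ENNReal.eq_top_of_forall_nnreal_le fun t => ?_
    obtain ⟨n, hn⟩ := h.exists_lt_jumpTime t
    refine le_trans ?_ (ENNReal.sum_le_tsum (Finset.range n))
    rw [Finset.sum_congr rfl fun k _ => by
      rw [Set.indicator_of_mem (show ω.1 ∈ avoidSet V k x from fun j _ => hex j), Pi.one_apply,
        one_mul]]
    rw [← ENNReal.ofNNReal_finsetSum]
    exact_mod_cast hn.le

lemma RegularHolding.hittingTime_eq_top_iff (h : RegularHolding ω) (V : Set (Fin d → R))
    (x : Fin d → R) : hittingTime V x ω = ∞ ↔ ∀ j, 1 ≤ j → stepWalk x ω.1 j ∉ V := by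
  simp only [hittingTime, ENNReal.add_eq_top, ENNReal.coe_ne_top, or_false, entranceTime,
    iInf_eq_top, walk_eq_stepWalk]
  constructor
  · intro h1 j hj hjV
    have h2 := h1 (jumpTime ω j - jumpTime ω 1)
    rw [tsub_add_cancel_of_le (h.strictMono.monotone hj), h.poissonCount_jumpTime] at h2
    exact h2 hjV
  · intro h1 t ht
    refine absurd ht (h1 _ ?_)
    have h2 := h.jumpTime_poissonCount_le (t + jumpTime ω 1)
    by_contra! h3
    obtain ⟨n, hn⟩ := h.exists_lt_jumpTime (t + jumpTime ω 1)
    have h4 : 1 ≤ poissonCount ω (t + jumpTime ω 1) := by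
      have hfin : {m : ℕ | 1 ≤ m ∧ jumpTime ω m ≤ t + jumpTime ω 1}.Finite :=
        (Set.finite_lt_nat n).subset fun m hm =>
          h.strictMono.lt_iff_lt.1 (lt_of_le_of_lt hm.2 hn)
      exact (Set.ncard_pos hfin).2 ⟨1, le_rfl, le_add_self⟩
    omega

end paths

lemma expectedEntranceFrom_eq_tsum {N : ℕ} (hd : 0 < d) (V : Set (Torus d N)) (x : Torus d N) :
    expectedEntranceFrom V x = ∑' k, ENNReal.ofReal (avoidProb V k x) := by
  have := isProbabilityMeasure_holdingLaw
  have := isProbabilityMeasure_stepLaw hd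
  have := isProbabilityMeasure_expMeasure_one
  have hm : ∀ k : ℕ, Measurable fun τ : ℕ → ℝ => ((τ k).toNNReal : ℝ≥0∞) := fun k =>
    (measurable_real_toNNReal.comp (measurable_pi_apply k)).coe_nnreal_ennreal
  have hmi : ∀ k : ℕ, Measurable ((avoidSet V k x).indicator (1 : (ℕ → Fin d × Bool) → ℝ≥0∞)) := fun k =>
    measurable_one.indicator (measurableSet_avoidSet V k x)
  have hmul : ∀ k : ℕ, AEMeasurable (fun ω : Sample d =>
      (avoidSet V k x).indicator 1 ω.1 * ((ω.2 k).toNNReal : ℝ≥0∞)) (sampleLaw d) := fun k =>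
    (((hmi k).comp measurable_fst).mul ((hm k).comp measurable_snd)).aemeasurable
  rw [expectedEntranceFrom, lintegral_congr_ae ((ae_regularHolding hd).mono fun ω h =>
    h.entranceTime_eq V x), lintegral_tsum (fun k => hmul k)]
  refine tsum_congr fun k => ?_
  rw [sampleLaw, lintegral_prod_mul (hmi k).aemeasurable (hm k).aemeasurable,
    lintegral_indicator_one (measurableSet_avoidSet V k x), stepLaw_avoidSet hd]
  have h1 := (measurePreserving_eval_infinitePi (fun _ : ℕ => expMeasure 1) k).lintegral_comp
    (f := fun y : ℝ => (y.toNNReal : ℝ≥0∞)) measurable_real_toNNReal.coe_nnreal_ennreal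
  rw [lintegral_toNNReal_expMeasure] at h1
  simp only [Function.eval] at h1
  rw [h1, mul_one]

lemma expectedEntranceFrom_eq {N : ℕ} [NeZero N] (hd : 0 < d) {V : Set (Torus d N)}
    (hV : V.Nonempty) (x : Torus d N) :
    expectedEntranceFrom V x = ENNReal.ofReal (meanEntrance V x) := by
  rw [expectedEntranceFrom_eq_tsum hd, meanEntrance, ENNReal.ofReal_tsum_of_nonneg
    (fun k => avoidProb_nonneg k x) (summable_avoidProb hd hV x)]

lemma expectedEntrance_eq {N : ℕ} [NeZero N] (hd : 0 < d) {V : Set (Torus d N)}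
    (hV : V.Nonempty) :
    expectedEntrance V = ENNReal.ofReal ((∑ x, meanEntrance V x) / (N : ℝ) ^ d) := by
  have hN : (0 : ℝ) < N := by exact_mod_cast NeZero.pos N
  rw [expectedEntrance, ← Finset.mul_sum, ENNReal.ofReal_div_of_pos (by positivity),
    ENNReal.ofReal_sum_of_nonneg fun x _ => meanEntrance_nonneg x, ENNReal.div_eq_inv_mul,
    ENNReal.ofReal_pow hN.le, ENNReal.ofReal_natCast]
  simp only [expectedEntranceFrom_eq hd hV]

lemma equilibriumMeasure_of_mem (hd : 0 < d) {V : Set (Lattice d)} {x : Lattice d} (hx : x ∈ V) :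
    equilibriumMeasure V x = ENNReal.ofReal (stepMean (escapeProb V) x) := by
  have := isProbabilityMeasure_holdingLaw
  have := isProbabilityMeasure_stepLaw hd
  rw [equilibriumMeasure, if_pos hx, ← stepLaw_forall_one_le hd]
  have h1 : {ω : Sample d | hittingTime V x ω = ∞} =ᵐ[sampleLaw d]
      {σ | ∀ j, 1 ≤ j → stepWalk x σ j ∉ V} ×ˢ (Set.univ : Set (ℕ → ℝ)) := by
    filter_upwards [ae_regularHolding hd] with ω h
    have := h.hittingTime_eq_top_iff V x
    simp only [eq_iff_iff]
    refine this.trans ?_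
    exact ⟨fun h => ⟨h, trivial⟩, fun h => h.1⟩
  rw [measure_congr h1, sampleLaw, Measure.prod_prod, measure_univ, mul_one]

lemma capacity_eq (hd : 0 < d) (V : Finset (Lattice d)) :
    capacity (V : Set (Lattice d)) =
      ENNReal.ofReal (∑ x ∈ V, stepMean (escapeProb (V : Set (Lattice d))) x) := by
  rw [capacity, tsum_eq_sum (s := V) fun x hx => by
    rw [equilibriumMeasure, if_neg (by simpa using hx)],
    ENNReal.ofReal_sum_of_nonneg fun x _ => stepMean_nonneg escapeProb_nonneg x]
  exact Finset.sum_congr rfl fun x hx => equilibriumMeasure_of_mem hd (Finset.mem_coe.2 hx)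

end

section

variable {d N : ℕ}

lemma liftCapacity_le (hd : 3 ≤ d) {V : Finset (Torus d N)} {r : ℝ} (hr : 1 ≤ r)
    (hV : (V : Set (Torus d N)) ⊆ torusBall 0 r) :
    liftCapacity V ≤ 36 * 18 ^ d * r ^ ((d : ℝ) - 2) := by
  classical
  have hr0 : 0 < r := by linarith
  set M : ℕ := ⌊r⌋₊ + 1 with hM
  have hM2 : 2 ≤ M := by
    have : 1 ≤ ⌊r⌋₊ := Nat.le_floor (by simpa using hr)
    omega
  have hMr : r ≤ M := by rw [hM]; push_cast; exact (Nat.lt_floor_add_one r).le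
  have hMr2 : (M : ℝ) ≤ 2 * r := by
    rw [hM]; push_cast; linarith [Nat.floor_le hr0.le]
  have hbox : V.image lift ⊆ latticeBox d M := by
    intro z hz
    obtain ⟨x, hx, rfl⟩ := Finset.mem_image.1 hz
    rw [mem_latticeBox]
    intro i
    have h1 := hV (Finset.mem_coe.2 hx) i
    rw [Pi.zero_apply, sub_zero] at h1
    have h2 := h1.trans hMr
    exact_mod_cast h2
  have h1 := sum_stepMean_escapeProb_le hd hM2 hbox
  rw [← liftCapacity_eq] at h1
  have hK : 0 ≤ liftCapacity V := Finset.sum_nonneg fun x _ => stepMean_nonneg escapeProb_nonneg _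
  have h2 : liftCapacity V * ((1 / 2 : ℝ) ^ d * (r ^ 2 / 36)) ≤ (9 * r) ^ d := by
    calc _ ≤ liftCapacity V * ((1 / 2 : ℝ) ^ d * ((M : ℝ) ^ 2 / 36)) := by gcongr
      _ ≤ (4 * M + 1) ^ d := h1
      _ ≤ (9 * r) ^ d := by gcongr; linarith
  have h3 : r ^ ((d : ℝ) - 2) = r ^ d / r ^ 2 := by
    rw [Real.rpow_sub hr0, Real.rpow_natCast]
    norm_cast
  rw [h3]
  calc liftCapacity V = liftCapacity V * ((1 / 2 : ℝ) ^ d * (r ^ 2 / 36)) * (2 ^ d * (36 / r ^ 2)) := by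
        rw [one_div, inv_pow]; field_simp
    _ ≤ (9 * r) ^ d * (2 ^ d * (36 / r ^ 2)) := by gcongr
    _ = _ := by
      rw [mul_pow, show (18 : ℝ) = 9 * 2 by norm_num, mul_pow]; ring

lemma liftCapacity_pos (hd : 3 ≤ d) {V : Finset (Torus d N)} (hV : V.Nonempty) :
    0 < liftCapacity V := by
  classical
  rw [liftCapacity_eq]
  exact sum_stepMean_escapeProb_pos hd (hV.image lift)

lemma capacity_lift_image (hd : 0 < d) (V : Finset (Torus d N)) :
    capacity (lift '' (V : Set (Torus d N))) = ENNReal.ofReal (liftCapacity V) := by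
  classical
  rw [liftCapacity_eq, ← capacity_eq hd, Finset.coe_image]

variable [NeZero N]

lemma sum_meanEntrance_pos (hd : 0 < d) {V : Set (Torus d N)} (hV : V.Nonempty) {r : ℝ}
    (hr : 1 ≤ r) (hrN : r ≤ (N : ℝ) / 4) (hVr : V ⊆ torusBall 0 r) :
    0 < ∑ x, meanEntrance V x := by
  set x : Torus d N := fun _ => ((N / 2 : ℕ) : ZMod N) with hx
  have hxV : x ∉ V := by
    intro h
    have h1 := hVr h ⟨0, hd⟩
    rw [Pi.zero_apply, sub_zero, hx, ZMod.valMinAbs_natCast_of_le_half le_rfl] at h1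
    rw [Int.cast_natCast] at h1
    have h2 : (N : ℝ) ≤ 2 * ((N / 2 : ℕ) : ℝ) + 1 := by
      have : N ≤ 2 * (N / 2) + 1 := by omega
      exact_mod_cast this
    have h3 := (le_abs_self _).trans h1
    linarith
  have h1 : 0 < meanEntrance V x := by
    rw [meanEntrance_of_notMem hd hV hxV]
    linarith [stepMean_nonneg (f := meanEntrance V) meanEntrance_nonneg x]
  exact h1.trans_le (Finset.single_le_sum (fun y _ => meanEntrance_nonneg y) (Finset.mem_univ x))

/-- The relative deviation of `E[H_V] cap(V)` from `N ^ d`. -/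
def deviation (V : Set (Torus d N)) : ℝ :=
  |(N : ℝ) ^ d / ((expectedEntrance V).toReal * (capacity (lift '' V)).toReal) - 1|

omit [NeZero N] in
lemma exists_deviation_le (d N : ℕ) :
    ∃ D : ℝ, ∀ [NeZero N] (V : Set (Torus d N)), deviation V ≤ D := by
  rcases Nat.eq_zero_or_pos N with h | h
  · exact ⟨0, fun {h'} => absurd h h'.out⟩
  · have : NeZero N := ⟨h.ne'⟩
    obtain ⟨D, hD⟩ := (Set.finite_range fun V : Set (Torus d N) => deviation V).bddAbove
    exact ⟨D, fun {_} V => hD ⟨V, rfl⟩⟩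

lemma abs_inv_sub_one_le {ρ η b : ℝ} (hη : η ≤ 1 / 4) (hb0 : 0 ≤ b) (hb : b ≤ 1 / 4) (hρ0 : 0 ≤ ρ)
    (h : |ρ - 1| ≤ η * ρ + b) : |1 / ρ - 1| ≤ η + 2 * b := by
  have h1 := abs_le.1 h
  have hρ : 3 / 5 ≤ ρ := by nlinarith
  have h2 : 1 / ρ - 1 = -(ρ - 1) / ρ := by field_simp; ring
  rw [h2, abs_div, abs_neg, abs_of_pos (show 0 < ρ by linarith), div_le_iff₀ (by linarith)]
  refine h.trans ?_
  nlinarith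

lemma deviation_le (hd : 3 ≤ d) {V : Set (Torus d N)} (hV : V.Nonempty) {r : ℝ} (hr : 1 ≤ r)
    (hrN : r ≤ (N : ℝ) / 4) (hVr : V ⊆ torusBall 0 r) {ε δ C₁ : ℝ} (hC₁ : 0 < C₁) (hε : 0 < ε)
    (hrε : r ≤ (N : ℝ) ^ (1 - ε)) (hδ : δ * (d + 2) = ε * (d - 2))
    (hgreen : ∀ z : Lattice d, (∀ i, |(z i : ℝ)| ≤ N / 2) →
      |greenUpTo (ZMod N) ((N : ℝ) ^ (2 + δ)) (fun i => (z i : ZMod N)) - green z| ≤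
        C₁ * (N : ℝ) ^ (2 - d + δ * (1 + d / 2)))
    (hη : 2 ^ d * (2 * √d) * (N : ℝ) ^ (-(δ / 2)) ≤ 1 / 4)
    (hb : (C₁ + 1) * (36 * 18 ^ d) * (N : ℝ) ^ (-(δ / 2)) ≤ 1 / 4) :
    deviation V ≤ (2 ^ d * (2 * √d) + 2 * ((C₁ + 1) * (36 * 18 ^ d))) * (N : ℝ) ^ (-(δ / 2)) := by
  classical
  have hd0 : 0 < d := by omega
  have h3 : (3 : ℝ) ≤ d := by exact_mod_cast hd
  have hN : (1 : ℝ) ≤ N := by exact_mod_cast NeZero.one_le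
  have hN0 : (0 : ℝ) < N := by linarith
  have hδ0 : 0 < δ := by
    have : 0 < δ * (d + 2) := by rw [hδ]; exact mul_pos hε (by linarith)
    exact pos_of_mul_pos_left this (by linarith)
  obtain ⟨W, rfl⟩ : ∃ W : Finset (Torus d N), V = W := ⟨V.toFinset, by simp⟩
  have hW : W.Nonempty := by simpa using hV
  set n : ℝ := (N : ℝ) ^ d with hn
  have hn0 : 0 < n := by positivity
  set K := liftCapacity W with hK
  set S := ∑ x, meanEntrance (W : Set (Torus d N)) x with hS
  have hK0 : 0 < K := liftCapacity_pos hd hW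
  have hS0 : 0 < S := sum_meanEntrance_pos hd0 hV hr hrN hVr
  set T : ℝ := (N : ℝ) ^ (2 + δ) with hT
  have hT0 : 0 < T := by positivity
  set p : ℝ := (N : ℝ) ^ (-(δ / 2)) with hp
  have hp0 : 0 < p := by positivity
  have hsqrt : 2 * N / √(T / d) = 2 * √d * p := by
    have h4 : √T = N * (N : ℝ) ^ (δ / 2) := by
      rw [Real.sqrt_eq_rpow, hT, ← Real.rpow_mul hN0.le]
      nth_rewrite 2 [← Real.rpow_one (N : ℝ)]
      rw [← Real.rpow_add hN0]
      ring_nf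
    rw [Real.sqrt_div' _ (by positivity), h4, hp, Real.rpow_neg hN0.le]
    field_simp
  have hmix : ∀ z : Torus d N, |n * walkKernel (ZMod N) T z - 1| ≤ 2 ^ d * (2 * √d) * p := by
    intro z
    have h4 : 2 * N / √(T / d) ≤ 1 := by
      rw [hsqrt]
      have h5 : (1 : ℝ) ≤ 2 ^ d := one_le_pow₀ one_le_two
      have h6 : 0 ≤ 2 * √d * p := by positivity
      nlinarith
    refine (abs_walkKernel_zmod_sub_le hd0 hT0 h4 z).trans_eq ?_
    rw [hsqrt]; ring
  set A : ℝ := C₁ * (N : ℝ) ^ (2 - d + δ * (1 + d / 2)) with hA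
  have hgr : ∀ x ∈ W, ∀ y ∈ W,
      |greenUpTo (ZMod N) T (x - y) - green (lift x - lift y)| ≤ A := by
    intro x hx y hy
    have hball : ∀ w ∈ W, ∀ i, |(lift w i : ℝ)| ≤ N / 4 := by
      intro w hw i
      have h1 := hVr (Finset.mem_coe.2 hw) i
      rw [Pi.zero_apply, sub_zero] at h1
      have h2 : |(lift w i : ℝ)| ≤ r := h1
      linarith
    have h4 := hgreen (lift x - lift y) fun i => by
      have h5 := abs_sub (lift x i : ℝ) (lift y i)
      have := hball x hx i
      have := hball y hy i
      rw [Pi.sub_apply]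
      push_cast
      linarith
    convert h4 using 4
    funext i
    simp [lift]
  have hKle : K ≤ 36 * 18 ^ d * (N : ℝ) ^ ((1 - ε) * (d - 2)) := by
    refine (liftCapacity_le hd hr hVr).trans ?_
    rw [Real.rpow_mul hN0.le]
    have : (0 : ℝ) ≤ d - 2 := by linarith
    gcongr
  have hAK : A * K ≤ C₁ * (36 * 18 ^ d) * p := by
    calc A * K ≤ A * (36 * 18 ^ d * (N : ℝ) ^ ((1 - ε) * (d - 2))) := by gcongr
      _ = C₁ * (36 * 18 ^ d) *
          ((N : ℝ) ^ (2 - d + δ * (1 + d / 2)) * (N : ℝ) ^ ((1 - ε) * (d - 2))) := by rw [hA]; ring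
      _ ≤ _ := by
        rw [← Real.rpow_add hN0]
        refine mul_le_mul_of_nonneg_left (Real.rpow_le_rpow_of_exponent_le hN ?_) (by positivity)
        nlinarith
  have hTK : T * K ≤ n * (36 * 18 ^ d * p) := by
    have h4 : T * (N : ℝ) ^ ((1 - ε) * (d - 2)) ≤ n * p := by
      rw [hn, ← Real.rpow_natCast, hT, hp, ← Real.rpow_add hN0, ← Real.rpow_add hN0]
      exact Real.rpow_le_rpow_of_exponent_le hN (by nlinarith)
    calc T * K ≤ T * (36 * 18 ^ d * (N : ℝ) ^ ((1 - ε) * (d - 2))) := by gcongr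
      _ = 36 * 18 ^ d * (T * (N : ℝ) ^ ((1 - ε) * (d - 2))) := by ring
      _ ≤ 36 * 18 ^ d * (n * p) := by gcongr
      _ = _ := by ring
  have hmain := abs_liftCapacity_mul_sub_le hd hW hT0.le hmix hgr
  have hdev : deviation (W : Set (Torus d N)) = |1 / (K * S / n / n) - 1| := by
    rw [deviation, expectedEntrance_eq hd0 hV, capacity_lift_image hd0,
      ENNReal.toReal_ofReal (by positivity), ENNReal.toReal_ofReal hK0.le]
    congr 2
    rw [← hS, ← hn]
    field_simp
  rw [hdev]
  refine (abs_inv_sub_one_le hη (by positivity) hb (by positivity) ?_).trans_eq (by ring)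
  have h5 : |K * S / n / n - 1| = |K * S / n - n| / n := by
    rw [← abs_of_pos hn0, ← abs_div, abs_of_pos hn0]
    congr 1
    field_simp
  rw [h5, div_le_iff₀ hn0]
  refine hmain.trans ?_
  have h6 : n * (A * K) ≤ n * (C₁ * (36 * 18 ^ d) * p) := by gcongr
  have h7 : 2 ^ d * (2 * √d) * p * (K * S / n / n) * n = 2 ^ d * (2 * √d) * p * (K * S / n) := by
    field_simp
  rw [add_mul, h7]
  linarith

end

end

end TorusWalk

theorem proposition3p5 (d : ℕ) (hd : 3 ≤ d) (ε : ℝ) (hε₀ : 0 < ε) (hε₁ : ε < 1) :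
    ∃ c : ℝ, 0 < c ∧ ∃ c' : ℝ, 0 < c' ∧
      ∀ (N : ℕ) [NeZero N] (r : ℝ), 1 ≤ r → r ≤ (N : ℝ) ^ (1 - ε) → r ≤ (N : ℝ) / 4 →
        ∀ V : Set (TorusWalk.Torus d N), V.Nonempty → V ⊆ TorusWalk.torusBall 0 r →
          (0 < TorusWalk.expectedEntrance V ∧ TorusWalk.expectedEntrance V < ∞) ∧
          (0 < TorusWalk.capacity (TorusWalk.lift '' V) ∧
            TorusWalk.capacity (TorusWalk.lift '' V) < ∞) ∧
          |(N : ℝ) ^ d / ((TorusWalk.expectedEntrance V).toReal *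
              (TorusWalk.capacity (TorusWalk.lift '' V)).toReal) - 1|
            ≤ c * (N : ℝ) ^ (-c') := by
  classical
  have hd0 : 0 < d := by omega
  have h3 : (3 : ℝ) ≤ d := by exact_mod_cast hd
  set δ : ℝ := ε * (d - 2) / (d + 2) with hδ
  have hδd : δ * (d + 2) = ε * (d - 2) := by rw [hδ]; field_simp
  have hδ0 : 0 < δ := div_pos (mul_pos hε₀ (by linarith)) (by linarith)
  have hδ1 : δ < 1 := by rw [hδ, div_lt_one (by linarith)]; nlinarith
  obtain ⟨C₁, hC₁, hgreen⟩ := TorusWalk.exists_abs_greenUpTo_sub_green_le hd hδ0 hδ1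
  set a : ℝ := 2 ^ d * (2 * √d) with ha
  set b : ℝ := (C₁ + 1) * (36 * 18 ^ d) with hb
  have hlim : ∀ c : ℝ, ∀ᶠ N : ℕ in Filter.atTop, c * (N : ℝ) ^ (-(δ / 2)) ≤ 1 / 4 := by
    intro c
    have h1 := ((tendsto_rpow_neg_atTop (half_pos hδ0)).comp
      tendsto_natCast_atTop_atTop).const_mul c
    rw [mul_zero] at h1
    exact (h1.eventually (gt_mem_nhds (by norm_num : (0 : ℝ) < 1 / 4))).mono fun _ h => h.le
  obtain ⟨N₀, hN₀⟩ := Filter.eventually_atTop.1 ((hlim a).and (hlim b))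
  choose D hD using TorusWalk.exists_deviation_le d
  have hDnn : ∀ N : ℕ, 0 ≤ |D N| * (N : ℝ) ^ (δ / 2) := fun N => by positivity
  have hab : 0 < a + 2 * b := by
    have : 0 < √(d : ℝ) := Real.sqrt_pos.2 (by linarith)
    positivity
  have hsum : 0 ≤ ∑ N ∈ Finset.range N₀, |D N| * (N : ℝ) ^ (δ / 2) :=
    Finset.sum_nonneg fun N _ => hDnn N
  refine ⟨a + 2 * b + ∑ N ∈ Finset.range N₀, |D N| * (N : ℝ) ^ (δ / 2), by linarith, δ / 2,
    half_pos hδ0, fun N _ r hr hrε hrN V hV hVr => ?_⟩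
  have hN0 : (0 : ℝ) < N := by exact_mod_cast NeZero.pos N
  have hp : 0 < (N : ℝ) ^ (-(δ / 2)) := by positivity
  refine ⟨?_, ?_, ?_⟩
  · rw [TorusWalk.expectedEntrance_eq hd0 hV]
    exact ⟨ENNReal.ofReal_pos.2 (div_pos (TorusWalk.sum_meanEntrance_pos hd0 hV hr hrN hVr)
      (by positivity)), ENNReal.ofReal_lt_top⟩
  · obtain ⟨W, rfl⟩ : ∃ W : Finset (TorusWalk.Torus d N), V = W := ⟨V.toFinset, by simp⟩
    rw [TorusWalk.capacity_lift_image hd0]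
    exact ⟨ENNReal.ofReal_pos.2 (TorusWalk.liftCapacity_pos hd (by simpa using hV)),
      ENNReal.ofReal_lt_top⟩
  · change TorusWalk.deviation V ≤ _
    rcases lt_or_ge N N₀ with hlt | hge
    · have h1 := Finset.single_le_sum (fun N _ => hDnn N) (Finset.mem_range.2 hlt)
      calc TorusWalk.deviation V ≤ |D N| := (hD N V).trans (le_abs_self _)
        _ = |D N| * (N : ℝ) ^ (δ / 2) * (N : ℝ) ^ (-(δ / 2)) := by
          rw [mul_assoc, ← Real.rpow_add hN0, add_neg_cancel, Real.rpow_zero, mul_one]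
        _ ≤ _ := by gcongr; linarith
    · obtain ⟨h1, h2⟩ := hN₀ N hge
      refine (TorusWalk.deviation_le hd hV hr hrN hVr hC₁ hε₀ hrε hδd (fun z hz => hgreen N z hz)
        h1 h2).trans ?_
      exact mul_le_mul_of_nonneg_right (by linarith) hp.le
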